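/- Let $G$ be a locally compact (Hausdorff) group and let $H$ be a closed subgroup of $G$. Let $C^*(G)$, $C^*(H)$ be the full group $C^*$-algebras, and in the pair $(C^*(G),C^*(H))$ identify $C^*(H)$ with its canonical image in the multiplier algebra $M(C^*(G))$. (a) The pair $(G,H)$ has Property $(T)$ if and only if the pair $(C^*(G),C^*(H))$ has Property $(T)$. (b) $G$ has Property $(T)$ if and only if $C^*(G)$ has Property $(T)$, and if and only if $C^*(G)$ has strong Property $(T)$. Here the notions are as follows. The pair $(G,H)$ has Property $(T)$ if every unitary (strongly continuous) representation $(u,\mathfrak H)$ of $G$ that admits a net of unit vectors $(\xi_i)$ with $\sup_{s\in Q}\|u(s)\xi_i-\xi_i\|\to 0$ for every compact $Q\subseteq G$ has a non-zero $H$-invariant vector. The group $G$ has Property $(T)$ if the pair $(G,G)$ does. For a (not necessarily unital) $C^*$-algebra $A$, a non-degenerate Hilbert $^*$-bimodule over $A$ is a Hilbert space $\mathfrak H$ with commuting non-degenerate $^*$-representation $\xi\mapsto a\cdot\xi$ and $^*$-anti-representation $\xi\mapsto\xi\cdot a$ of $A$; both extend uniquely to $M(A)$. A net $(\xi_i)$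 in $\mathfrak H$ is almost-$\mathfrak K_A$-central if $\sup_{x\in L}\|x\cdot\xi_i-\xi_i\cdot x\|\to 0$ for every $L\subseteq M(A)$ that is compact for the strict topology (the weakest topology making $x\mapsto xa$ and $x\mapsto ax$ norm-continuous from $M(A)$ to $A$ for all $a\in A$). For a non-degenerate $C^*$-subalgebra $B\subseteq M(A)$ put $\mathfrak H^B=\{\xi\in\mathfrak H: b\cdot\xi=\xi\cdot b\ \text{for all } b\in B\}$, and let $P^B$ be the orthogonal projection onto $\mathfrak H^B$. The pair $(A,B)$ has Property $(T)$ (respectively, strong Property $(T)$) if for every non-degenerate Hilbert $^*$-bimodule $\mathfrak H$ over $A$ and every almost-$\mathfrak K_A$-central net $(\xi_i)$ of unit vectors in $\mathfrak H$, one has $\mathfrak H^B\neq\{0\}$ (respectively, $\|\xi_i-P^B\xi_i\|\to 0$). Finally, $A$ has (strong) Property $(T)$ if the pair $(A,A)$ does. -/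

import Mathlib

open MeasureTheory Filter Topology
open scoped CompactlySupported MultiplierAlgebra

universe u

set_option linter.unusedSectionVars false

namespace KazhdanT

noncomputable section

/-- A unitary representation of a topological group `G` on a Hilbert space `E`: a homomorphism into
the unitary group of `E` that is continuous for the strong operator topology. -/
structure UnitaryRep (G : Type*) [Group G] [TopologicalSpace G] (E : Type*)
    [NormedAddCommGroup E] [InnerProductSpace ℂ E] [CompleteSpace E] where
  toHom : G →* unitary (E →L[ℂ] E)
  continuous_apply : ∀ ξ : E, Continuous fun g => (toHom g : E →L[ℂ] E) ξ

namespace UnitaryRep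

section Basic

variable {G : Type*} [Group G] [TopologicalSpace G]
  {K : Type*} [Group K] [TopologicalSpace K]
  {E : Type*} [NormedAddCommGroup E] [InnerProductSpace ℂ E] [CompleteSpace E]

/-- The operator `π g`. -/
def op (π : UnitaryRep G E) (g : G) : E →L[ℂ] E := (π.toHom g : E →L[ℂ] E)

theorem continuous_op (π : UnitaryRep G E) (ξ : E) : Continuous fun g => π.op g ξ :=
  π.continuous_apply ξ

theorem op_one (π : UnitaryRep G E) : π.op 1 = 1 := by simp [op]

theorem op_mul (π : UnitaryRep G E) (g h : G) : π.op (g * h) = π.op g * π.op h := by simp [op]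

theorem star_op (π : UnitaryRep G E) (g : G) : star (π.op g) = π.op g⁻¹ := by
  simp only [op, map_inv]; rfl

theorem norm_op_apply (π : UnitaryRep G E) (g : G) (ξ : E) : ‖π.op g ξ‖ = ‖ξ‖ := by
  have h : star (π.op g) * π.op g = 1 := by rw [star_op, ← op_mul]; simp [op_one]
  have h2 : inner ℂ (π.op g ξ) (π.op g ξ) = inner ℂ ξ ξ := by
    rw [← ContinuousLinearMap.adjoint_inner_right, ← ContinuousLinearMap.star_eq_adjoint]
    change inner ℂ ξ ((star (π.op g) * π.op g) ξ) = _
    rw [h]; rfl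
  rw [inner_self_eq_norm_sq_to_K, inner_self_eq_norm_sq_to_K] at h2
  have h3 : ‖π.op g ξ‖ ^ 2 = ‖ξ‖ ^ 2 := by exact_mod_cast h2
  exact (sq_eq_sq₀ (norm_nonneg _) (norm_nonneg _)).1 h3

/-- The representation `π ∘ φ` of `K`, for a continuous homomorphism `φ : K → G`. -/
def comp (π : UnitaryRep G E) (φ : K →ₜ* G) : UnitaryRep K E where
  toHom := π.toHom.comp φ.toMonoidHom
  continuous_apply ξ := (π.continuous_apply ξ).comp φ.continuous_toFun

theorem comp_op (π : UnitaryRep G E) (φ : K →ₜ* G) (k : K) : (π.comp φ).op k = π.op (φ k) := rfl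

end Basic

section Integral

variable {G : Type*} [Group G] [TopologicalSpace G] [IsTopologicalGroup G] [LocallyCompactSpace G]
  [MeasurableSpace G] [BorelSpace G]
  {E : Type*} [NormedAddCommGroup E] [InnerProductSpace ℂ E] [CompleteSpace E]

theorem continuous_smul_op (π : UnitaryRep G E) (f : C_c(G, ℂ)) (ξ : E) :
    Continuous fun x => f x • π.op x ξ :=
  f.continuous_toFun.smul (π.continuous_op ξ)

theorem integrable_smul_op (π : UnitaryRep G E) (f : C_c(G, ℂ)) (ξ : E) :
    Integrable (fun x => f x • π.op x ξ) (Measure.haar : Measure G) :=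
  (π.continuous_smul_op f ξ).integrable_of_hasCompactSupport f.hasCompactSupport.smul_right

/-- The integrated form `π(f) ξ = ∫ f(x) π(x) ξ dx` with respect to the left Haar measure. -/
def integral (π : UnitaryRep G E) (f : C_c(G, ℂ)) : E →L[ℂ] E :=
  LinearMap.mkContinuous
    { toFun := fun ξ => ∫ x, f x • π.op x ξ ∂(Measure.haar : Measure G)
      map_add' := fun ξ η => by
        simp only [map_add, smul_add]
        exact integral_add (π.integrable_smul_op f ξ) (π.integrable_smul_op f η)
      map_smul' := fun c ξ => by
        simp only [map_smul, RingHom.id_apply, smul_comm _ c]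
        exact integral_smul c _ }
    (∫ x, ‖f x‖ ∂(Measure.haar : Measure G))
    (fun ξ => by
      refine (norm_integral_le_integral_norm _).trans (le_of_eq ?_)
      simp only [norm_smul, norm_op_apply]
      exact integral_mul_const _ _)

theorem integral_apply (π : UnitaryRep G E) (f : C_c(G, ℂ)) (ξ : E) :
    π.integral f ξ = ∫ x, f x • π.op x ξ ∂(Measure.haar : Measure G) := rfl

theorem norm_integral_le (π : UnitaryRep G E) (f : C_c(G, ℂ)) :
    ‖π.integral f‖ ≤ ∫ x, ‖f x‖ ∂(Measure.haar : Measure G) :=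
  LinearMap.mkContinuous_norm_le _ (integral_nonneg fun _ => norm_nonneg _) _

theorem integral_add (π : UnitaryRep G E) (f g : C_c(G, ℂ)) :
    π.integral (f + g) = π.integral f + π.integral g := by
  ext ξ
  simp only [integral_apply, _root_.add_apply, CompactlySupportedContinuousMap.add_apply,
    add_smul]
  exact MeasureTheory.integral_add (π.integrable_smul_op f ξ) (π.integrable_smul_op g ξ)

theorem integral_smul (π : UnitaryRep G E) (c : ℂ) (f : C_c(G, ℂ)) :
    π.integral (c • f) = c • π.integral f := by
  ext ξ
  simp only [integral_apply, _root_.smul_apply,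
    CompactlySupportedContinuousMap.smul_apply, smul_assoc]
  exact MeasureTheory.integral_smul c _

end Integral

end UnitaryRep

section Convolution

variable {G : Type*} [Group G] [TopologicalSpace G] [IsTopologicalGroup G] [LocallyCompactSpace G]
  [T2Space G] [MeasurableSpace G] [BorelSpace G]
  {K : Type*} [Group K] [TopologicalSpace K] [IsTopologicalGroup K] [LocallyCompactSpace K]
  [T2Space K] [MeasurableSpace K] [BorelSpace K]
  {E : Type*} [NormedAddCommGroup E] [InnerProductSpace ℂ E] [CompleteSpace E]

theorem isCompact_twisted (φ : K →ₜ* G) (f : C_c(K, ℂ)) (a : C_c(G, ℂ)) :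
    IsCompact ((fun p : K × G => (φ p.1 * p.2, p.1)) '' (tsupport f ×ˢ tsupport a)) := by
  have h : Continuous φ := φ.continuous_toFun
  exact (f.hasCompactSupport.isCompact.prod a.hasCompactSupport.isCompact).image
    (((h.comp continuous_fst).mul continuous_snd).prodMk continuous_fst)

theorem mem_twisted (φ : K →ₜ* G) (f : C_c(K, ℂ)) (a : C_c(G, ℂ)) (x : G) (k : K)
    (h : f k * a ((φ k)⁻¹ * x) ≠ 0) :
    (x, k) ∈ (fun p : K × G => (φ p.1 * p.2, p.1)) '' (tsupport f ×ˢ tsupport a) := by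
  simp only [ne_eq, mul_eq_zero, not_or] at h
  exact ⟨(k, (φ k)⁻¹ * x), ⟨subset_tsupport _ h.1, subset_tsupport _ h.2⟩, by simp⟩

theorem continuous_twisted (φ : K →ₜ* G) (f : C_c(K, ℂ)) (a : C_c(G, ℂ)) :
    Continuous (Function.uncurry fun (x : G) (k : K) => f k * a ((φ k)⁻¹ * x)) := by
  have h : Continuous φ := φ.continuous_toFun
  exact (f.continuous_toFun.comp continuous_snd).mul
    (a.continuous_toFun.comp (((h.comp continuous_snd).inv).mul continuous_fst))

/-- The convolution of `f` on `K` with `a` on `G` along a continuous homomorphism `φ : K → G`: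
`(f * a)(x) = ∫_K f(k) a(φ(k)⁻¹ x) dk`. For `φ = id` this is the usual convolution on `G`, and for
the inclusion of a closed subgroup it is the convolution by the measure `f(k) dk`
on that subgroup. -/
def conv (φ : K →ₜ* G) (f : C_c(K, ℂ)) (a : C_c(G, ℂ)) : C_c(G, ℂ) where
  toFun x := ∫ k, f k * a ((φ k)⁻¹ * x) ∂(Measure.haar : Measure K)
  continuous_toFun := by
    rw [← continuousOn_univ]
    refine continuousOn_integral_of_compact_support f.hasCompactSupport.isCompact
      (continuous_twisted φ f a).continuousOn ?_
    intro x k _ hk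
    rw [image_eq_zero_of_notMem_tsupport hk, zero_mul]
  hasCompactSupport' := by
    refine HasCompactSupport.intro ((isCompact_twisted φ f a).image continuous_fst) ?_
    intro x hx
    refine (integral_congr_ae (Eventually.of_forall fun k => ?_)).trans (integral_zero K ℂ)
    by_contra h
    exact hx ⟨_, mem_twisted φ f a x k h, rfl⟩

theorem conv_apply (φ : K →ₜ* G) (f : C_c(K, ℂ)) (a : C_c(G, ℂ)) (x : G) :
    conv φ f a x = ∫ k, f k * a ((φ k)⁻¹ * x) ∂(Measure.haar : Measure K) := rfl

theorem integral_conv (π : UnitaryRep G E) (φ : K →ₜ* G) (f : C_c(K, ℂ)) (a : C_c(G, ℂ)) :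
    π.integral (conv φ f a) = (π.comp φ).integral f * π.integral a := by
  ext ξ
  have h1 : π.integral (conv φ f a) ξ = ∫ x, (∫ k, (f k * a ((φ k)⁻¹ * x)) • π.op x ξ
      ∂(Measure.haar : Measure K)) ∂(Measure.haar : Measure G) := by
    rw [UnitaryRep.integral_apply]
    refine integral_congr_ae (Eventually.of_forall fun x => ?_)
    exact (integral_smul_const (fun k => f k * a ((φ k)⁻¹ * x)) (π.op x ξ)).symm
  rw [h1, integral_integral_swap_of_hasCompactSupport
    (f := fun (x : G) (k : K) => (f k * a ((φ k)⁻¹ * x)) • π.op x ξ)]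
  · change _ = (π.comp φ).integral f (π.integral a ξ)
    rw [UnitaryRep.integral_apply]
    refine integral_congr_ae (Eventually.of_forall fun k => ?_)
    change ∫ x, (f k * a ((φ k)⁻¹ * x)) • π.op x ξ ∂(Measure.haar : Measure G) =
      f k • (π.comp φ).op k (π.integral a ξ)
    rw [← integral_mul_left_eq_self _ (φ k), UnitaryRep.comp_op, UnitaryRep.integral_apply,
      ← ContinuousLinearMap.integral_comp_comm _ (π.integrable_smul_op a ξ),
      ← MeasureTheory.integral_smul]
    refine integral_congr_ae (Eventually.of_forall fun x => ?_)
    simp [UnitaryRep.op_mul, mul_smul]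
  · exact (continuous_twisted φ f a).smul ((π.continuous_op ξ).comp continuous_fst)
  · refine HasCompactSupport.intro (isCompact_twisted φ f a) ?_
    rintro ⟨x, k⟩ h
    by_contra h0
    exact h (mem_twisted φ f a x k (left_ne_zero_of_smul h0))

/-- The modular function, in the normalization `∫ f(y x) dy = Δ(x) ∫ f(y) dy` for the left Haar
measure `dy`. -/
def modular (x : G) : ℝ := (Measure.modularCharacterFun x : ℝ)

theorem modular_mul (x y : G) : modular (x * y) = modular x * modular y := by
  simp [modular, Measure.modularCharacterFun_map_mul]

theorem modular_one : modular (1 : G) = 1 := by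
  simp [modular, Measure.modularCharacterFun_map_one]

theorem modular_inv_mul (x : G) : modular x⁻¹ * modular x = 1 := by
  rw [← modular_mul, inv_mul_cancel, modular_one]

theorem integral_mul_right_modular (f : C_c(G, ℝ)) (x : G) :
    ∫ y, f (y * x) ∂(Measure.haar : Measure G) =
      modular x * ∫ y, f y ∂(Measure.haar : Measure G) := by
  have h := Measure.integral_isMulLeftInvariant_eq_smul_of_hasCompactSupport
    (Measure.map (· * x) Measure.haar) (Measure.haar : Measure G) f.continuous_toFun
    f.hasCompactSupport
  rw [← Measure.modularCharacterFun_eq_haarScalarFactor, integral_smul_nnreal_measure,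
    integral_map (AEMeasurable.mul_const aemeasurable_id' _)
      (Continuous.aestronglyMeasurable f.continuous_toFun)] at h
  exact h

theorem exists_bump : ∃ f : C_c(G, ℝ), ∫ y, f y ∂(Measure.haar : Measure G) ≠ 0 := by
  obtain ⟨⟨f, f_cont⟩, f_comp, f_nonneg, f_one⟩ :
    ∃ f : C(G, ℝ), HasCompactSupport f ∧ 0 ≤ f ∧ f 1 ≠ 0 := exists_continuous_nonneg_pos 1
  exact ⟨⟨⟨f, f_cont⟩, f_comp⟩,
    (f_cont.integral_pos_of_hasCompactSupport_nonneg_nonzero f_comp f_nonneg f_one).ne'⟩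

theorem continuous_modular : Continuous (modular : G → ℝ) := by
  obtain ⟨f, hf⟩ := exists_bump (G := G)
  have h : (modular : G → ℝ) = fun x => (∫ y, f (y⁻¹ * x) ∂(Measure.haar : Measure G).inv) /
      ∫ y, f y ∂(Measure.haar : Measure G) := by
    funext x
    rw [eq_div_iff hf, ← integral_mul_right_modular, Measure.inv, integral_map]
    · simp
    · exact measurable_inv.aemeasurable
    · exact (f.continuous_toFun.comp (continuous_inv.mul continuous_const)).aestronglyMeasurable
  rw [h]
  exact (continuous_integral_apply_inv_mul f.continuous_toFun f.hasCompactSupport).div_const _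

/-- The involution `f*(x) = Δ(x) conj (f(x⁻¹))` on `C_c(G)`, with `Δ` normalized as above. -/
def conjStar (f : C_c(G, ℂ)) : C_c(G, ℂ) where
  toFun x := (modular x : ℂ) * star (f x⁻¹)
  continuous_toFun := (Complex.continuous_ofReal.comp continuous_modular).mul
    (continuous_star.comp (f.continuous_toFun.comp continuous_inv))
  hasCompactSupport' := by
    refine HasCompactSupport.intro (f.hasCompactSupport.isCompact.image continuous_inv) ?_
    intro x hx
    have : f x⁻¹ = 0 := by
      apply image_eq_zero_of_notMem_tsupport
      intro h
      exact hx ⟨x⁻¹, h, inv_inv x⟩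
    simp [this]

theorem conjStar_apply (f : C_c(G, ℂ)) (x : G) :
    conjStar f x = (modular x : ℂ) * star (f x⁻¹) := rfl

theorem integral_inv_modular {F : Type*} [NormedAddCommGroup F] [NormedSpace ℝ F]
    [CompleteSpace F]
    (k : G → F) (hk : Continuous k) (hk' : HasCompactSupport k) :
    ∫ x, modular x • k x⁻¹ ∂(Measure.haar : Measure G) = ∫ x, k x ∂(Measure.haar : Measure G) := by
  obtain ⟨f, hf⟩ := exists_bump (G := G)
  have key : (∫ y, f y ∂(Measure.haar : Measure G)) •
      ∫ x, modular x • k x⁻¹ ∂(Measure.haar : Measure G) =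
      (∫ y, f y ∂(Measure.haar : Measure G)) • ∫ x, k x ∂(Measure.haar : Measure G) := by
    calc _ = ∫ x, f x • ∫ y, modular y • k y⁻¹ ∂(Measure.haar : Measure G)
          ∂(Measure.haar : Measure G) := (integral_smul_const _ _).symm
      _ = ∫ x, (∫ y, f x • (modular (x⁻¹ * y) • k (y⁻¹ * x)) ∂(Measure.haar : Measure G))
          ∂(Measure.haar : Measure G) := by
        refine integral_congr_ae (Eventually.of_forall fun x => ?_)
        change f x • ∫ y, modular y • k y⁻¹ ∂(Measure.haar : Measure G) = _
        rw [← integral_mul_left_eq_self _ x⁻¹, ← MeasureTheory.integral_smul]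
        simp
      _ = ∫ y, (∫ x, f x • (modular (x⁻¹ * y) • k (y⁻¹ * x)) ∂(Measure.haar : Measure G))
          ∂(Measure.haar : Measure G) := by
        refine integral_integral_swap_of_hasCompactSupport
          (f := fun x y : G => f x • (modular (x⁻¹ * y) • k (y⁻¹ * x))) ?_ ?_
        · refine (f.continuous_toFun.comp continuous_fst).smul ((continuous_modular.comp ?_).smul
            (hk.comp ?_))
          · exact (continuous_fst.inv).mul continuous_snd
          · exact (continuous_snd.inv).mul continuous_fst
        · refine HasCompactSupport.intro ((f.hasCompactSupport.isCompact.prod hk').image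
            (f := fun p : G × G => (p.1, p.1 * p.2⁻¹)) (by fun_prop)) ?_
          rintro ⟨x, y⟩ h
          by_contra h0
          refine h ⟨(x, y⁻¹ * x), ⟨subset_tsupport _ (left_ne_zero_of_smul h0),
            subset_tsupport _ (right_ne_zero_of_smul (right_ne_zero_of_smul h0))⟩, by simp⟩
      _ = ∫ y, (∫ x, f (y * x) • (modular x⁻¹ • k x) ∂(Measure.haar : Measure G))
          ∂(Measure.haar : Measure G) := by
        refine integral_congr_ae (Eventually.of_forall fun y => ?_)
        change ∫ x, f x • (modular (x⁻¹ * y) • k (y⁻¹ * x)) ∂(Measure.haar : Measure G) = _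
        rw [← integral_mul_left_eq_self _ y]
        simp
      _ = ∫ x, (∫ y, f (y * x) • (modular x⁻¹ • k x) ∂(Measure.haar : Measure G))
          ∂(Measure.haar : Measure G) := by
        refine integral_integral_swap_of_hasCompactSupport
          (f := fun y x : G => f (y * x) • (modular x⁻¹ • k x)) ?_ ?_
        · refine (f.continuous_toFun.comp continuous_mul).smul ((continuous_modular.comp ?_).smul
            (hk.comp continuous_snd))
          exact continuous_snd.inv
        · refine HasCompactSupport.intro ((f.hasCompactSupport.isCompact.prod hk').image
            (f := fun p : G × G => (p.1 * p.2⁻¹, p.2)) (by fun_prop)) ?_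
          rintro ⟨y, x⟩ h
          by_contra h0
          refine h ⟨(y * x, x), ⟨subset_tsupport _ (left_ne_zero_of_smul h0),
            subset_tsupport _ (right_ne_zero_of_smul (right_ne_zero_of_smul h0))⟩, by simp⟩
      _ = ∫ x, (∫ y, f y ∂(Measure.haar : Measure G)) • k x ∂(Measure.haar : Measure G) := by
        refine integral_congr_ae (Eventually.of_forall fun x => ?_)
        change ∫ y, f (y * x) • (modular x⁻¹ • k x) ∂(Measure.haar : Measure G) = _
        rw [integral_smul_const, integral_mul_right_modular, smul_smul, mul_right_comm,
          mul_comm (modular x), modular_inv_mul, one_mul]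
      _ = _ := MeasureTheory.integral_smul _ _
  exact smul_right_injective _ hf key

theorem integral_conjStar (π : UnitaryRep G E) (f : C_c(G, ℂ)) :
    π.integral (conjStar f) = star (π.integral f) := by
  rw [ContinuousLinearMap.star_eq_adjoint, ContinuousLinearMap.eq_adjoint_iff]
  intro ξ η
  rw [← inner_conj_symm, UnitaryRep.integral_apply, UnitaryRep.integral_apply,
    ← integral_inner (π.integrable_smul_op _ _), ← integral_inner (π.integrable_smul_op _ _),
    ← integral_conj,
    ← integral_inv_modular (fun x => inner ℂ ξ (f x • π.op x η))]
  · refine integral_congr_ae (Eventually.of_forall fun x => ?_)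
    have h : inner ℂ η (π.op x ξ) = inner ℂ (π.op x⁻¹ η) ξ := by
      rw [← UnitaryRep.star_op, ContinuousLinearMap.star_eq_adjoint,
        ContinuousLinearMap.adjoint_inner_left]
    have h2 : (starRingEnd ℂ) (inner ℂ η (π.op x ξ)) = inner ℂ ξ (π.op x⁻¹ η) := by
      rw [h, inner_conj_symm]
    simp only [conjStar_apply, inner_smul_right, map_mul, h2, Complex.conj_ofReal,
      Complex.real_smul, mul_assoc]
    simp
  · exact continuous_const.inner (π.continuous_smul_op f η)
  · refine f.hasCompactSupport.mono ?_
    intro x hx h0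
    exact hx (by simp [h0])

end Convolution
section GroupCStar

/-- The space `C_c(G)`, to be endowed with the maximal C*-seminorm. -/
def GroupAlg (G : Type u) [TopologicalSpace G] : Type u := C_c(G, ℂ)

instance (G : Type u) [TopologicalSpace G] : AddCommGroup (GroupAlg G) :=
  inferInstanceAs (AddCommGroup C_c(G, ℂ))

instance (G : Type u) [TopologicalSpace G] : Module ℂ (GroupAlg G) :=
  inferInstanceAs (Module ℂ C_c(G, ℂ))

variable {G : Type u} [Group G] [TopologicalSpace G] [IsTopologicalGroup G] [LocallyCompactSpace G]
  [T2Space G] [MeasurableSpace G] [BorelSpace G]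
  {K : Type u} [Group K] [TopologicalSpace K] [IsTopologicalGroup K] [LocallyCompactSpace K]
  [T2Space K] [MeasurableSpace K] [BorelSpace K]

/-- The set of all `‖π(f)‖`, where `π` runs over the unitary representations of `G`. Cyclic
representations of `G` live, up to equivalence, on Hilbert spaces in the universe of `G`, so this
universe is no restriction. -/
def repNorms (f : C_c(G, ℂ)) : Set ℝ :=
  {r | ∃ (E : Type u) (_ : NormedAddCommGroup E) (_ : InnerProductSpace ℂ E) (_ : CompleteSpace E)
    (π : UnitaryRep G E), r = ‖π.integral f‖}

theorem repNorms_bddAbove (f : C_c(G, ℂ)) : BddAbove (repNorms f) := by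
  refine ⟨∫ x, ‖f x‖ ∂(Measure.haar : Measure G), ?_⟩
  rintro r ⟨E, _, _, _, π, rfl⟩
  exact π.norm_integral_le f

/-- The maximal C*-seminorm `‖f‖ = sup_π ‖π(f)‖` on `C_c(G)`. -/
def maxNorm (f : C_c(G, ℂ)) : ℝ := sSup (repNorms f)

section

variable {E : Type u} [NormedAddCommGroup E] [InnerProductSpace ℂ E] [CompleteSpace E]

theorem norm_integral_le_maxNorm (π : UnitaryRep G E) (f : C_c(G, ℂ)) :
    ‖π.integral f‖ ≤ maxNorm f :=
  le_csSup (repNorms_bddAbove f) ⟨E, _, _, _, π, rfl⟩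

end

theorem maxNorm_nonneg (f : C_c(G, ℂ)) : 0 ≤ maxNorm f :=
  Real.sSup_nonneg (by rintro r ⟨E, _, _, _, π, rfl⟩; exact norm_nonneg _)

theorem maxNorm_le {f : C_c(G, ℂ)} {C : ℝ} (hC : 0 ≤ C)
    (h : ∀ (E : Type u) [NormedAddCommGroup E] [InnerProductSpace ℂ E] [CompleteSpace E]
      (π : UnitaryRep G E), ‖π.integral f‖ ≤ C) : maxNorm f ≤ C :=
  Real.sSup_le (by rintro r ⟨E, _, _, _, π, rfl⟩; exact h E π) hC

theorem maxNorm_smul_le (c : ℂ) (f : C_c(G, ℂ)) : maxNorm (c • f) ≤ ‖c‖ * maxNorm f := by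
  refine maxNorm_le (mul_nonneg (norm_nonneg _) (maxNorm_nonneg f)) fun E _ _ _ π => ?_
  rw [π.integral_smul, norm_smul]
  exact mul_le_mul_of_nonneg_left (norm_integral_le_maxNorm π f) (norm_nonneg _)

/-- The maximal C*-seminorm as a seminorm of additive groups. -/
def maxSeminorm : AddGroupSeminorm (GroupAlg G) where
  toFun f := maxNorm (G := G) f
  map_zero' := by
    refine le_antisymm (maxNorm_le le_rfl fun E _ _ _ π => ?_) (maxNorm_nonneg _)
    have h : π.integral (0 : C_c(G, ℂ)) = 0 := by
      simpa using π.integral_smul 0 (0 : C_c(G, ℂ))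
    exact (congrArg norm h).trans_le (by simp)
  add_le' f g := by
    refine maxNorm_le (add_nonneg (maxNorm_nonneg _) (maxNorm_nonneg _)) fun E _ _ _ π => ?_
    refine (congrArg norm (π.integral_add f g)).trans_le ((norm_add_le _ _).trans ?_)
    exact add_le_add (norm_integral_le_maxNorm π f) (norm_integral_le_maxNorm π g)
  neg' f := by
    have h (f : C_c(G, ℂ)) : maxNorm (-f) ≤ maxNorm f := by
      rw [← neg_one_smul ℂ f]
      refine (maxNorm_smul_le (-1) f).trans (le_of_eq ?_)
      rw [norm_neg, norm_one, one_mul]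
    have h2 (f : C_c(G, ℂ)) : maxNorm f ≤ maxNorm (-f) := by
      have := h (-f)
      rwa [neg_neg] at this
    exact le_antisymm (h f) (h2 f)

instance : SeminormedAddCommGroup (GroupAlg G) := maxSeminorm.toSeminormedAddCommGroup

theorem GroupAlg.norm_def (f : GroupAlg G) : ‖f‖ = maxNorm (G := G) f := rfl

instance : NormedSpace ℂ (GroupAlg G) where
  norm_smul_le c f := maxNorm_smul_le c f

variable (G) in
/-- The full group C*-algebra `C*(G)`: the Hausdorff completion of the convolution algebra `C_c(G)`
for the maximal C*-seminorm. -/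
def GroupCStar : Type u := UniformSpace.Completion (GroupAlg G)

instance : NormedAddCommGroup (GroupCStar G) :=
  inferInstanceAs (NormedAddCommGroup (UniformSpace.Completion (GroupAlg G)))

instance : NormedSpace ℂ (GroupCStar G) :=
  inferInstanceAs (NormedSpace ℂ (UniformSpace.Completion (GroupAlg G)))

instance : CompleteSpace (GroupCStar G) :=
  inferInstanceAs (CompleteSpace (UniformSpace.Completion (GroupAlg G)))

/-- The canonical isometric map `C_c(G) → C*(G)`. -/
def ofCcL : GroupAlg G →L[ℂ] GroupCStar G :=
  (UniformSpace.Completion.toComplL : GroupAlg G →L[ℂ] UniformSpace.Completion (GroupAlg G))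

/-- The canonical map `C_c(G) → C*(G)`. -/
def ofCc (f : C_c(G, ℂ)) : GroupCStar G := ofCcL (G := G) f

theorem norm_ofCc (f : C_c(G, ℂ)) : ‖ofCc f‖ = maxNorm f :=
  UniformSpace.Completion.norm_coe (E := GroupAlg G) f

theorem denseRange_ofCcL : DenseRange (ofCcL : GroupAlg G → GroupCStar G) :=
  UniformSpace.Completion.denseRange_coe

theorem isUniformInducing_ofCcL : IsUniformInducing (ofCcL : GroupAlg G → GroupCStar G) :=
  UniformSpace.Completion.isUniformInducing_coe (GroupAlg G)

theorem GroupCStar.induction {p : GroupCStar G → Prop} (x : GroupCStar G)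
    (hp : IsClosed {x | p x}) (h : ∀ f : C_c(G, ℂ), p (ofCc f)) : p x :=
  isClosed_property denseRange_ofCcL hp h x

section Lift

variable {E : Type u} [NormedAddCommGroup E] [InnerProductSpace ℂ E] [CompleteSpace E]

/-- The representation of `C*(G)` associated with a unitary representation of `G`. -/
def UnitaryRep.lift (π : UnitaryRep G E) : GroupCStar G →L[ℂ] (E →L[ℂ] E) :=
  (LinearMap.mkContinuous
    ({ toFun := fun f => π.integral f
       map_add' := π.integral_add
       map_smul' := π.integral_smul } : GroupAlg G →ₗ[ℂ] (E →L[ℂ] E)) 1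
    (fun f => by rw [one_mul]; exact norm_integral_le_maxNorm π f)).extend ofCcL

theorem UnitaryRep.lift_ofCc (π : UnitaryRep G E) (f : C_c(G, ℂ)) :
    π.lift (ofCc f) = π.integral f :=
  ContinuousLinearMap.extend_eq _ denseRange_ofCcL isUniformInducing_ofCcL _

theorem UnitaryRep.norm_lift_le (π : UnitaryRep G E) (x : GroupCStar G) : ‖π.lift x‖ ≤ ‖x‖ := by
  refine GroupCStar.induction (p := fun x => ‖π.lift x‖ ≤ ‖x‖) x
    (isClosed_le (by fun_prop) (by fun_prop)) fun f => ?_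
  rw [π.lift_ofCc, norm_ofCc]
  exact norm_integral_le_maxNorm π f

end Lift

theorem GroupCStar.norm_le_of_rep {x : GroupCStar G} {C : ℝ} (hC : 0 ≤ C)
    (h : ∀ (E : Type u) [NormedAddCommGroup E] [InnerProductSpace ℂ E] [CompleteSpace E]
      (π : UnitaryRep G E), ‖π.lift x‖ ≤ C) : ‖x‖ ≤ C := by
  refine le_of_forall_pos_le_add fun ε hε => ?_
  obtain ⟨f, hf⟩ : ∃ f : C_c(G, ℂ), dist x (ofCc f) < ε / 2 :=
    denseRange_ofCcL.exists_dist_lt x (half_pos hε)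
  have hf' : ‖x - ofCc f‖ < ε / 2 := by rwa [← dist_eq_norm]
  have h2 : ‖ofCc (G := G) f‖ ≤ C + ε / 2 := by
    rw [norm_ofCc]
    refine maxNorm_le (by positivity) fun E _ _ _ π => ?_
    rw [← π.lift_ofCc, ← sub_sub_cancel x (ofCc (G := G) f), map_sub]
    exact (norm_sub_le _ _).trans (add_le_add (h E π) ((π.norm_lift_le _).trans hf'.le))
  calc ‖x‖ = ‖(x - ofCc f) + ofCc f‖ := by rw [sub_add_cancel]
    _ ≤ ‖x - ofCc f‖ + ‖ofCc (G := G) f‖ := norm_add_le _ _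
    _ ≤ C + ε := by linarith

theorem GroupCStar.ext_rep {x y : GroupCStar G}
    (h : ∀ (E : Type u) [NormedAddCommGroup E] [InnerProductSpace ℂ E] [CompleteSpace E]
      (π : UnitaryRep G E), π.lift x = π.lift y) : x = y := by
  rw [← sub_eq_zero, ← norm_le_zero_iff]
  refine GroupCStar.norm_le_of_rep le_rfl fun E _ _ _ π => ?_
  rw [map_sub, h E π, sub_self, norm_zero]

theorem ofCc_conv_add_right (φ : K →ₜ* G) (f : C_c(K, ℂ)) (a b : C_c(G, ℂ)) :
    ofCc (conv φ f (a + b)) = ofCc (conv φ f a) + ofCc (conv φ f b) :=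
  GroupCStar.ext_rep fun E _ _ _ π => by
    rw [map_add, π.lift_ofCc, π.lift_ofCc, π.lift_ofCc, integral_conv, integral_conv,
      integral_conv, ← mul_add, π.integral_add]

theorem ofCc_conv_smul_right (φ : K →ₜ* G) (f : C_c(K, ℂ)) (c : ℂ) (a : C_c(G, ℂ)) :
    ofCc (conv φ f (c • a)) = c • ofCc (conv φ f a) :=
  GroupCStar.ext_rep fun E _ _ _ π => by
    rw [map_smul, π.lift_ofCc, π.lift_ofCc, integral_conv, integral_conv,
      ← mul_smul_comm, π.integral_smul]

/-- The extension to `C*(G)` of `a ↦ f * a`, for `f` in `C_c(K)`. -/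
def convCc (φ : K →ₜ* G) (f : C_c(K, ℂ)) : GroupCStar G →L[ℂ] GroupCStar G :=
  (LinearMap.mkContinuous
    ({ toFun := fun a => ofCc (conv φ f a)
       map_add' := fun a b => ofCc_conv_add_right φ f a b
       map_smul' := fun c a => ofCc_conv_smul_right φ f c a } : GroupAlg G →ₗ[ℂ] GroupCStar G) (maxNorm f)
    (fun a => GroupCStar.norm_le_of_rep (mul_nonneg (maxNorm_nonneg _) (norm_nonneg _))
      fun E _ _ _ π => by
        refine (congrArg norm ((π.lift_ofCc _).trans (integral_conv π φ f a))).trans_le ?_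
        exact (norm_mul_le _ _).trans (mul_le_mul (norm_integral_le_maxNorm _ f)
          (norm_integral_le_maxNorm π a) (norm_nonneg _) (maxNorm_nonneg _)))).extend ofCcL

theorem convCc_ofCc (φ : K →ₜ* G) (f : C_c(K, ℂ)) (a : C_c(G, ℂ)) :
    convCc φ f (ofCc a) = ofCc (conv φ f a) :=
  ContinuousLinearMap.extend_eq _ denseRange_ofCcL isUniformInducing_ofCcL _

section

variable {E : Type u} [NormedAddCommGroup E] [InnerProductSpace ℂ E] [CompleteSpace E]

theorem lift_convCc (π : UnitaryRep G E) (φ : K →ₜ* G) (f : C_c(K, ℂ)) (y : GroupCStar G) :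
    π.lift (convCc φ f y) = (π.comp φ).integral f * π.lift y := by
  refine GroupCStar.induction
    (p := fun y => π.lift (convCc φ f y) = (π.comp φ).integral f * π.lift y) y
    (isClosed_eq (by fun_prop) (by fun_prop)) fun a => ?_
  rw [convCc_ofCc, π.lift_ofCc, π.lift_ofCc, integral_conv]

end

theorem convCc_add (φ : K →ₜ* G) (f g : C_c(K, ℂ)) :
    convCc φ (f + g) = convCc φ f + convCc φ g := by
  ext y
  refine GroupCStar.ext_rep fun E _ _ _ π => ?_
  rw [_root_.add_apply, map_add, lift_convCc, lift_convCc, lift_convCc, ← add_mul,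
    UnitaryRep.integral_add]

theorem convCc_smul (φ : K →ₜ* G) (c : ℂ) (f : C_c(K, ℂ)) :
    convCc φ (c • f) = c • convCc φ f := by
  ext y
  refine GroupCStar.ext_rep fun E _ _ _ π => ?_
  rw [_root_.smul_apply, map_smul, lift_convCc, lift_convCc, ← smul_mul_assoc,
    UnitaryRep.integral_smul]

theorem norm_convCc_le (φ : K →ₜ* G) (f : C_c(K, ℂ)) : ‖convCc φ f‖ ≤ maxNorm f := by
  refine ContinuousLinearMap.opNorm_le_bound _ (maxNorm_nonneg _) fun y => ?_
  refine GroupCStar.norm_le_of_rep (mul_nonneg (maxNorm_nonneg _) (norm_nonneg _))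
    fun E _ _ _ π => ?_
  rw [lift_convCc]
  exact (norm_mul_le _ _).trans (mul_le_mul (norm_integral_le_maxNorm _ f)
    (π.norm_lift_le y) (norm_nonneg _) (maxNorm_nonneg _))

/-- The extension of the convolution `C_c(K) × C_c(G) → C_c(G)` along `φ : K → G` to a bilinear map
`C*(K) × C*(G) → C*(G)`. -/
def convL (φ : K →ₜ* G) : GroupCStar K →L[ℂ] GroupCStar G →L[ℂ] GroupCStar G :=
  (LinearMap.mkContinuous
    ({ toFun := fun f => convCc φ f
       map_add' := fun f g => convCc_add φ f g
       map_smul' := fun c f => convCc_smul φ c f } :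
      GroupAlg K →ₗ[ℂ] GroupCStar G →L[ℂ] GroupCStar G) 1
    (fun f => by rw [one_mul]; exact norm_convCc_le φ f)).extend ofCcL

theorem convL_ofCc (φ : K →ₜ* G) (f : C_c(K, ℂ)) (a : C_c(G, ℂ)) :
    convL φ (ofCc f) (ofCc a) = ofCc (conv φ f a) := by
  have h : convL φ (ofCc f) = convCc φ f :=
    ContinuousLinearMap.extend_eq _ denseRange_ofCcL isUniformInducing_ofCcL _
  rw [h, convCc_ofCc]

theorem ofCc_conjStar_add (f g : C_c(G, ℂ)) :
    ofCc (conjStar (f + g)) = ofCc (conjStar f) + ofCc (conjStar g) :=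
  GroupCStar.ext_rep fun E _ _ _ π => by
    rw [map_add, π.lift_ofCc, π.lift_ofCc, π.lift_ofCc, integral_conjStar, integral_conjStar,
      integral_conjStar, ← star_add, π.integral_add]

theorem ofCc_conjStar_smul (c : ℂ) (f : C_c(G, ℂ)) :
    ofCc (conjStar (c • f)) = starRingEnd ℂ c • ofCc (conjStar f) :=
  GroupCStar.ext_rep fun E _ _ _ π => by
    rw [map_smul, π.lift_ofCc, π.lift_ofCc, integral_conjStar, integral_conjStar,
      π.integral_smul, star_smul, starRingEnd_apply]

theorem norm_ofCc_conjStar_le (f : C_c(G, ℂ)) : ‖ofCc (conjStar f)‖ ≤ maxNorm f :=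
  GroupCStar.norm_le_of_rep (maxNorm_nonneg _) fun E _ _ _ π => by
    rw [π.lift_ofCc, integral_conjStar, norm_star]
    exact norm_integral_le_maxNorm π f

/-- The extension of the involution of `C_c(G)` to `C*(G)`. -/
def starL : GroupCStar G →L⋆[ℂ] GroupCStar G :=
  (LinearMap.mkContinuous
    ({ toFun := fun f => ofCc (conjStar f)
       map_add' := fun f g => ofCc_conjStar_add f g
       map_smul' := fun c f => ofCc_conjStar_smul c f } :
      GroupAlg G →ₛₗ[starRingEnd ℂ] GroupCStar G) 1
    (fun f => by rw [one_mul]; exact norm_ofCc_conjStar_le f)).extend ofCcL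

theorem starL_ofCc (f : C_c(G, ℂ)) : starL (ofCc f) = ofCc (conjStar f) :=
  ContinuousLinearMap.extend_eq _ denseRange_ofCcL isUniformInducing_ofCcL _

section

variable {E : Type u} [NormedAddCommGroup E] [InnerProductSpace ℂ E] [CompleteSpace E]

theorem lift_convL (π : UnitaryRep G E) (φ : K →ₜ* G) (x : GroupCStar K) (y : GroupCStar G) :
    π.lift (convL φ x y) = (π.comp φ).lift x * π.lift y := by
  refine GroupCStar.induction
    (p := fun x => π.lift (convL φ x y) = (π.comp φ).lift x * π.lift y) x
    (isClosed_eq (by fun_prop) (by fun_prop)) fun f => ?_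
  refine GroupCStar.induction
    (p := fun y => π.lift (convL φ (ofCc f) y) = (π.comp φ).lift (ofCc f) * π.lift y) y
    (isClosed_eq (by fun_prop) (by fun_prop)) fun a => ?_
  rw [convL_ofCc, UnitaryRep.lift_ofCc, UnitaryRep.lift_ofCc, UnitaryRep.lift_ofCc, integral_conv]

theorem lift_starL (π : UnitaryRep G E) (x : GroupCStar G) :
    π.lift (starL x) = star (π.lift x) := by
  refine GroupCStar.induction (p := fun x => π.lift (starL x) = star (π.lift x)) x
    (isClosed_eq (by fun_prop) (by fun_prop)) fun f => ?_
  rw [starL_ofCc, UnitaryRep.lift_ofCc, UnitaryRep.lift_ofCc, integral_conjStar]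

end

instance : Mul (GroupCStar G) := ⟨fun x y => convL (ContinuousMonoidHom.id G) x y⟩

instance : Star (GroupCStar G) := ⟨fun x => starL x⟩

theorem ofCc_mul (f g : C_c(G, ℂ)) :
    ofCc f * ofCc g = ofCc (conv (ContinuousMonoidHom.id G) f g) :=
  convL_ofCc _ f g

theorem star_ofCc (f : C_c(G, ℂ)) : star (ofCc f) = ofCc (conjStar f) := starL_ofCc f

section

variable {E : Type u} [NormedAddCommGroup E] [InnerProductSpace ℂ E] [CompleteSpace E]

theorem UnitaryRep.lift_mul (π : UnitaryRep G E) (x y : GroupCStar G) :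
    π.lift (x * y) = π.lift x * π.lift y := lift_convL π _ x y

theorem UnitaryRep.lift_star (π : UnitaryRep G E) (x : GroupCStar G) :
    π.lift (star x) = star (π.lift x) := lift_starL π x

end

instance : NonUnitalNormedRing (GroupCStar G) where
  __ := (inferInstance : NormedAddCommGroup (GroupCStar G))
  mul := (· * ·)
  left_distrib x y z := map_add (convL (ContinuousMonoidHom.id G) x) y z
  right_distrib x y z := by
    change convL (ContinuousMonoidHom.id G) (x + y) z = _
    rw [map_add]; rfl
  zero_mul x := by
    change convL (ContinuousMonoidHom.id G) 0 x = _
    rw [map_zero]; rfl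
  mul_zero x := map_zero (convL (ContinuousMonoidHom.id G) x)
  mul_assoc x y z := GroupCStar.ext_rep fun E _ _ _ π => by
    simp only [UnitaryRep.lift_mul, mul_assoc]
  norm_mul_le x y := GroupCStar.norm_le_of_rep (by positivity) fun E _ _ _ π => by
    rw [π.lift_mul]
    exact (norm_mul_le _ _).trans
      (mul_le_mul (π.norm_lift_le x) (π.norm_lift_le y) (norm_nonneg _) (norm_nonneg _))

instance : StarRing (GroupCStar G) where
  star_involutive x := GroupCStar.ext_rep fun E _ _ _ π => by
    simp only [UnitaryRep.lift_star, star_star]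
  star_mul x y := GroupCStar.ext_rep fun E _ _ _ π => by
    simp only [UnitaryRep.lift_star, UnitaryRep.lift_mul, star_mul]
  star_add x y := map_add starL x y

instance : NonUnitalCStarAlgebra (GroupCStar G) where
  norm_mul_self_le x := by
    have h : ‖x‖ ≤ Real.sqrt ‖star x * x‖ := by
      refine GroupCStar.norm_le_of_rep (Real.sqrt_nonneg _) fun E _ _ _ π => ?_
      refine Real.le_sqrt_of_sq_le ?_
      rw [sq, ← CStarRing.norm_star_mul_self, ← π.lift_star, ← π.lift_mul]
      exact π.norm_lift_le _
    calc ‖x‖ * ‖x‖ ≤ Real.sqrt ‖star x * x‖ * Real.sqrt ‖star x * x‖ :=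
          mul_self_le_mul_self (norm_nonneg _) h
      _ = ‖star x * x‖ := Real.mul_self_sqrt (norm_nonneg _)
  smul_assoc c x y := by
    change convL (ContinuousMonoidHom.id G) (c • x) y = _
    rw [map_smul]; rfl
  smul_comm c x y := (map_smul (convL (ContinuousMonoidHom.id G) x) c y).symm
  star_smul c x := map_smulₛₗ starL c x

/-- The canonical *-homomorphism `C*(K) → M(C*(G))` induced by a continuous homomorphism
`φ : K → G`: an element of `C*(K)` acts on `C*(G)` by convolution along `φ`. -/
def toMultiplier (φ : K →ₜ* G) : GroupCStar K →⋆ₙₐ[ℂ] 𝓜(ℂ, GroupCStar G) where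
  toFun x :=
    { fst := convL φ x
      snd := (((starₗᵢ ℂ : GroupCStar G ≃ₗᵢ⋆[ℂ] GroupCStar G) :
        GroupCStar G →L⋆[ℂ] GroupCStar G).comp (convL φ (star x))).comp
        ((starₗᵢ ℂ : GroupCStar G ≃ₗᵢ⋆[ℂ] GroupCStar G) : GroupCStar G →L⋆[ℂ] GroupCStar G)
      central := fun y z => GroupCStar.ext_rep fun E _ _ _ π => by
        change π.lift (star (convL φ (star x) (star y)) * z) = π.lift (y * convL φ x z)
        simp only [UnitaryRep.lift_mul, UnitaryRep.lift_star, lift_convL, star_mul, star_star,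
          mul_assoc] }
  map_smul' c x := by
    ext y
    · exact congrArg (fun T => T y) (map_smul (convL φ) c x)
    · change star (convL φ (star (c • x)) (star y)) = c • star (convL φ (star x) (star y))
      rw [star_smul, map_smul, _root_.smul_apply, star_smul, star_star]
  map_zero' := by
    ext y
    · exact congrArg (fun T => T y) (map_zero (convL φ))
    · change star (convL φ (star 0) (star y)) = 0
      rw [star_zero, map_zero, _root_.zero_apply, star_zero]
  map_add' x x' := by
    ext y
    · exact congrArg (fun T => T y) (map_add (convL φ) x x')
    · change star (convL φ (star (x + x')) (star y)) =
        star (convL φ (star x) (star y)) + star (convL φ (star x') (star y))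
      rw [star_add, map_add, _root_.add_apply, star_add]
  map_mul' x x' := by
    ext y
    · refine GroupCStar.ext_rep fun E _ _ _ π => ?_
      change π.lift (convL φ (x * x') y) = π.lift (convL φ x (convL φ x' y))
      simp only [lift_convL, UnitaryRep.lift_mul, mul_assoc]
    · refine GroupCStar.ext_rep fun E _ _ _ π => ?_
      change π.lift (star (convL φ (star (x * x')) (star y))) =
        π.lift (star (convL φ (star x') (star (star (convL φ (star x) (star y))))))
      simp only [lift_convL, UnitaryRep.lift_mul, UnitaryRep.lift_star, star_mul, star_star,
        mul_assoc]
  map_star' x := by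
    ext y
    · change convL φ (star x) y = star (star (convL φ (star x) (star (star y))))
      rw [star_star, star_star]
    · change star (convL φ (star (star x)) (star y)) = star (convL φ x (star y))
      rw [star_star]

end GroupCStar
section Bimodule

variable {A : Type*} [NonUnitalCStarAlgebra A]
  {E : Type*} [NormedAddCommGroup E] [InnerProductSpace ℂ E] [CompleteSpace E]

/-- A *-representation `π : A → B(E)` is non-degenerate if the vectors `π(a) ξ` span a dense
subspace of `E`. -/
def IsNondegenerate (π : A →⋆ₙₐ[ℂ] (E →L[ℂ] E)) : Prop :=
  (Submodule.span ℂ {η : E | ∃ (a : A) (ξ : E), π a ξ = η}).topologicalClosure = ⊤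

theorem IsNondegenerate.denseRange {π : A →⋆ₙₐ[ℂ] (E →L[ℂ] E)} (hπ : IsNondegenerate π) :
    DenseRange (Finsupp.lsum ℂ fun a : A => (π a : E →ₗ[ℂ] E)) := by
  have h : Submodule.span ℂ {η : E | ∃ (a : A) (ξ : E), π a ξ = η} ≤
      LinearMap.range (Finsupp.lsum ℂ fun a : A => (π a : E →ₗ[ℂ] E)) := by
    rw [Submodule.span_le]
    rintro _ ⟨a, ξ, rfl⟩
    exact ⟨Finsupp.single a ξ, by simp⟩
  have hd := Submodule.dense_iff_topologicalClosure_eq_top.2 hπ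
  exact hd.mono h

theorem norm_lsum_le (π : A →⋆ₙₐ[ℂ] (E →L[ℂ] E)) (L : A →L[ℂ] A)
    (hL : ∀ a b, L (a * b) = L a * b) (z : A →₀ E) :
    ‖Finsupp.lsum ℂ (fun a : A => (π (L a) : E →ₗ[ℂ] E)) z‖ ≤
      ‖L‖ * ‖Finsupp.lsum ℂ (fun a : A => (π a : E →ₗ[ℂ] E)) z‖ := by
  let _ : PartialOrder A := CStarAlgebra.spectralOrder A
  have _ : StarOrderedRing A := CStarAlgebra.spectralOrderedRing A
  have hl := CStarAlgebra.increasingApproximateUnit A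
  have hπ : Continuous π := map_continuous π
  have ht : Tendsto (fun u => Finsupp.lsum ℂ (fun a : A => (π (L (u * a)) : E →ₗ[ℂ] E)) z)
      (CStarAlgebra.approximateUnit A)
      (𝓝 (Finsupp.lsum ℂ (fun a : A => (π (L a) : E →ₗ[ℂ] E)) z)) := by
    simp only [Finsupp.lsum_apply, Finsupp.sum]
    refine tendsto_finsetSum _ fun a _ => ?_
    have h1 : Continuous fun b : A => π (L b) (z a) := by fun_prop
    exact (h1.tendsto a).comp (hl.tendsto_mul_right a)
  refine le_of_tendsto ht.norm ?_
  filter_upwards [hl.eventually_norm] with u hu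
  have h2 : Finsupp.lsum ℂ (fun a : A => (π (L (u * a)) : E →ₗ[ℂ] E)) z =
      π (L u) (Finsupp.lsum ℂ (fun a : A => (π a : E →ₗ[ℂ] E)) z) := by
    simp only [Finsupp.lsum_apply, Finsupp.sum, map_sum]
    refine Finset.sum_congr rfl fun a _ => ?_
    rw [hL, map_mul]; rfl
  rw [h2]
  refine ((π (L u)).le_opNorm _).trans (mul_le_mul_of_nonneg_right ?_ (norm_nonneg _))
  refine (NonUnitalStarAlgHom.norm_apply_le π _).trans ((L.le_opNorm u).trans ?_)
  exact mul_le_of_le_one_right (norm_nonneg _) hu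

theorem existsUnique_extension {π : A →⋆ₙₐ[ℂ] (E →L[ℂ] E)} (hπ : IsNondegenerate π)
    (L : A →L[ℂ] A) (hL : ∀ a b, L (a * b) = L a * b) :
    ∃! T : E →L[ℂ] E, ∀ (a : A) (ξ : E), T (π a ξ) = π (L a) ξ := by
  refine ⟨(Finsupp.lsum ℂ fun a : A => (π (L a) : E →ₗ[ℂ] E)).extendOfNorm
    (Finsupp.lsum ℂ fun a : A => (π a : E →ₗ[ℂ] E)), fun a ξ => ?_, fun T hT => ?_⟩
  · have h := LinearMap.extendOfNorm_eq hπ.denseRange ⟨‖L‖, norm_lsum_le π L hL⟩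
      (Finsupp.single a ξ)
    simpa using h
  · refine (LinearMap.extendOfNorm_unique hπ.denseRange ‖L‖ (norm_lsum_le π L hL) T ?_).symm
    ext a ξ
    simpa using hT a ξ

theorem eq_of_mul_left {a b : A} (h : ∀ c : A, c * a = c * b) : a = b := by
  rw [← sub_eq_zero, ← CStarRing.star_mul_self_eq_zero_iff, mul_sub, h, sub_self]

theorem eq_of_mul_right {a b : A} (h : ∀ c : A, a * c = b * c) : a = b := by
  rw [← sub_eq_zero, ← CStarRing.mul_star_self_eq_zero_iff, sub_mul, h, sub_self]

theorem multiplier_fst_mul (x : 𝓜(ℂ, A)) (a b : A) : x.fst (a * b) = x.fst a * b :=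
  eq_of_mul_left fun c => by rw [← x.central, ← mul_assoc, x.central, mul_assoc]

theorem multiplier_snd_mul (x : 𝓜(ℂ, A)) (a b : A) : x.snd (a * b) = a * x.snd b :=
  eq_of_mul_right fun c => by rw [x.central, mul_assoc, ← x.central, mul_assoc]

/-- Right multiplication `a ↦ a x` by a multiplier `x`, as a map of the opposite algebra. -/
def opRight (x : 𝓜(ℂ, A)) : Aᵐᵒᵖ →L[ℂ] Aᵐᵒᵖ :=
  ((MulOpposite.opContinuousLinearEquiv ℂ : A ≃L[ℂ] Aᵐᵒᵖ) : A →L[ℂ] Aᵐᵒᵖ).comp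
    (x.snd.comp ((MulOpposite.opContinuousLinearEquiv ℂ : A ≃L[ℂ] Aᵐᵒᵖ).symm : Aᵐᵒᵖ →L[ℂ] A))

theorem opRight_op (x : 𝓜(ℂ, A)) (a : A) :
    opRight x (MulOpposite.op a) = MulOpposite.op (x.snd a) := rfl

theorem opRight_mul (x : 𝓜(ℂ, A)) (a b : Aᵐᵒᵖ) : opRight x (a * b) = opRight x a * b := by
  change MulOpposite.op (x.snd (b.unop * a.unop)) = MulOpposite.op (x.snd a.unop) * b
  rw [multiplier_snd_mul]; rfl

variable (A E) in
/-- A non-degenerate Hilbert *-bimodule over `A`: a Hilbert space `E` with a non-degenerate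
*-representation `a · ξ = left a ξ` and a non-degenerate *-anti-representation
`ξ · a = right (op a) ξ` of `A` (that is, a *-representation of the opposite algebra) that commute
with each other. -/
structure HilbertBimodule where
  left : A →⋆ₙₐ[ℂ] (E →L[ℂ] E)
  right : Aᵐᵒᵖ →⋆ₙₐ[ℂ] (E →L[ℂ] E)
  left_right_comm : ∀ (a b : A) (ξ : E),
    left a (right (MulOpposite.op b) ξ) = right (MulOpposite.op b) (left a ξ)
  left_nondegenerate : IsNondegenerate left
  right_nondegenerate : IsNondegenerate right

namespace HilbertBimodule

/-- The extension of the left action to the multiplier algebra: `M.leftMul x ξ = x · ξ`, determined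
by `x · (a · ξ) = (x a) · ξ`. -/
def leftMul (M : HilbertBimodule A E) (x : 𝓜(ℂ, A)) : E →L[ℂ] E :=
  (existsUnique_extension M.left_nondegenerate x.fst (multiplier_fst_mul x)).choose

theorem leftMul_left (M : HilbertBimodule A E) (x : 𝓜(ℂ, A)) (a : A) (ξ : E) :
    M.leftMul x (M.left a ξ) = M.left (x.fst a) ξ :=
  (existsUnique_extension M.left_nondegenerate x.fst (multiplier_fst_mul x)).choose_spec.1 a ξ

theorem leftMul_unique (M : HilbertBimodule A E) (x : 𝓜(ℂ, A)) (T : E →L[ℂ] E)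
    (hT : ∀ (a : A) (ξ : E), T (M.left a ξ) = M.left (x.fst a) ξ) : T = M.leftMul x :=
  (existsUnique_extension M.left_nondegenerate x.fst (multiplier_fst_mul x)).choose_spec.2 T hT

/-- The extension of the right action to the multiplier algebra: `M.rightMul x ξ = ξ · x`,
determined by `(ξ · a) · x = ξ · (a x)`. -/
def rightMul (M : HilbertBimodule A E) (x : 𝓜(ℂ, A)) : E →L[ℂ] E :=
  (existsUnique_extension M.right_nondegenerate (opRight x) (opRight_mul x)).choose

theorem rightMul_right (M : HilbertBimodule A E) (x : 𝓜(ℂ, A)) (a : A) (ξ : E) :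
    M.rightMul x (M.right (MulOpposite.op a) ξ) = M.right (MulOpposite.op (x.snd a)) ξ :=
  (existsUnique_extension M.right_nondegenerate (opRight x) (opRight_mul x)).choose_spec.1 _ ξ

theorem rightMul_unique (M : HilbertBimodule A E) (x : 𝓜(ℂ, A)) (T : E →L[ℂ] E)
    (hT : ∀ (a : A) (ξ : E),
      T (M.right (MulOpposite.op a) ξ) = M.right (MulOpposite.op (x.snd a)) ξ) :
    T = M.rightMul x :=
  (existsUnique_extension M.right_nondegenerate (opRight x) (opRight_mul x)).choose_spec.2 T
    fun a ξ => hT a.unop ξ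

theorem leftMul_coe (M : HilbertBimodule A E) (a : A) : M.leftMul (a : 𝓜(ℂ, A)) = M.left a :=
  (M.leftMul_unique _ _ fun b ξ => by
    change M.left a (M.left b ξ) = M.left (a * b) ξ
    rw [map_mul]; rfl).symm

theorem rightMul_coe (M : HilbertBimodule A E) (a : A) :
    M.rightMul (a : 𝓜(ℂ, A)) = M.right (MulOpposite.op a) :=
  (M.rightMul_unique _ _ fun b ξ => by
    change M.right _ (M.right _ ξ) = M.right (MulOpposite.op (b * a)) ξ
    rw [MulOpposite.op_mul, map_mul]; rfl).symm

end HilbertBimodule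

variable (A) in
/-- The strict topology on `M(A)`: the weakest topology for which `x ↦ x a` and `x ↦ a x` are
continuous from `M(A)` to `A` with its norm topology, for every `a` in `A`. -/
@[reducible] def strictTopology : TopologicalSpace 𝓜(ℂ, A) :=
  ⨅ a : A, TopologicalSpace.induced (fun x : 𝓜(ℂ, A) => x.fst a) inferInstance ⊓
    TopologicalSpace.induced (fun x : 𝓜(ℂ, A) => x.snd a) inferInstance

namespace HilbertBimodule

/-- A net `ξ` is almost central if `sup_{x ∈ L} ‖x · ξ i - ξ i · x‖ → 0` for every strictly compact
subset `L` of `M(A)` (written out with `ε`). -/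
def IsAlmostCentral (M : HilbertBimodule A E) {ι : Type*} [Preorder ι] (ξ : ι → E) : Prop :=
  ∀ L : Set 𝓜(ℂ, A), @IsCompact _ (strictTopology A) L →
    ∀ ε : ℝ, 0 < ε → ∀ᶠ i in atTop, ∀ x ∈ L, ‖M.leftMul x (ξ i) - M.rightMul x (ξ i)‖ < ε

/-- The closed subspace of `B`-central vectors, `b · ξ = ξ · b` for all `b` in `B`. -/
def centralVectors (M : HilbertBimodule A E) (B : NonUnitalStarSubalgebra ℂ 𝓜(ℂ, A)) :
    Submodule ℂ E where
  carrier := {ξ | ∀ b ∈ B, M.leftMul b ξ = M.rightMul b ξ}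
  add_mem' hξ hη b hb := by rw [map_add, map_add, hξ b hb, hη b hb]
  zero_mem' b _ := by rw [map_zero, map_zero]
  smul_mem' c ξ hξ b hb := by rw [map_smul, map_smul, hξ b hb]

theorem isClosed_centralVectors (M : HilbertBimodule A E)
    (B : NonUnitalStarSubalgebra ℂ 𝓜(ℂ, A)) : IsClosed (M.centralVectors B : Set E) := by
  have h : (M.centralVectors B : Set E) = ⋂ b ∈ B, {ξ | M.leftMul b ξ = M.rightMul b ξ} := by
    ext ξ
    simp [centralVectors]
  rw [h]
  exact isClosed_biInter fun b _ =>
    isClosed_eq (M.leftMul b).continuous (M.rightMul b).continuous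

instance (M : HilbertBimodule A E) (B : NonUnitalStarSubalgebra ℂ 𝓜(ℂ, A)) :
    CompleteSpace (M.centralVectors B) :=
  (M.isClosed_centralVectors B).completeSpace_coe

end HilbertBimodule

end Bimodule

section PropertyT

/-- Property (T) for a pair `(A, B)`, where `B` is a non-degenerate C*-subalgebra of `M(A)`: every
non-degenerate Hilbert *-bimodule over `A` with an almost central net of unit vectors has a nonzero
`B`-central vector. Hilbert spaces and index sets in the universe of `A` suffice, since one can
pass to the sub-bimodule generated by one vector for each pair of a strictly compact subset of
`M(A)` and a natural number. -/
def PairPropertyT (A : Type u) [NonUnitalCStarAlgebra A]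
    (B : NonUnitalStarSubalgebra ℂ 𝓜(ℂ, A)) : Prop :=
  ∀ (E : Type u) [NormedAddCommGroup E] [InnerProductSpace ℂ E] [CompleteSpace E]
    (M : HilbertBimodule A E) (ι : Type u) [Preorder ι] [IsDirectedOrder ι] [Nonempty ι]
    (ξ : ι → E), (∀ i, ‖ξ i‖ = 1) → M.IsAlmostCentral ξ →
      ∃ η ∈ M.centralVectors B, η ≠ 0

/-- Strong Property (T) for a pair `(A, B)`: in every non-degenerate Hilbert *-bimodule over `A`,
every almost central net of unit vectors `ξ` satisfies `‖ξ i - P (ξ i)‖ → 0`, where `P` is the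
orthogonal projection onto the `B`-central vectors. -/
def PairStrongPropertyT (A : Type u) [NonUnitalCStarAlgebra A]
    (B : NonUnitalStarSubalgebra ℂ 𝓜(ℂ, A)) : Prop :=
  ∀ (E : Type u) [NormedAddCommGroup E] [InnerProductSpace ℂ E] [CompleteSpace E]
    (M : HilbertBimodule A E) (ι : Type u) [Preorder ι] [IsDirectedOrder ι] [Nonempty ι]
    (ξ : ι → E), (∀ i, ‖ξ i‖ = 1) → M.IsAlmostCentral ξ →
      Tendsto (fun i => ‖ξ i - (M.centralVectors B).starProjection (ξ i)‖) atTop (𝓝 0)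

/-- The canonical image of `A` in `M(A)`. -/
def selfImage (A : Type u) [NonUnitalCStarAlgebra A] : NonUnitalStarSubalgebra ℂ 𝓜(ℂ, A) :=
  NonUnitalStarAlgHom.range (DoubleCentralizer.coeHom : A →⋆ₙₐ[ℂ] 𝓜(ℂ, A))

/-- Property (T) for the C*-algebra `A`, that is, for the pair `(A, A)`. -/
def CStarPropertyT (A : Type u) [NonUnitalCStarAlgebra A] : Prop := PairPropertyT A (selfImage A)

/-- Strong Property (T) for the C*-algebra `A`, that is, for the pair `(A, A)`. -/
def CStarStrongPropertyT (A : Type u) [NonUnitalCStarAlgebra A] : Prop :=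
  PairStrongPropertyT A (selfImage A)

/-- A net `ξ` is almost invariant under a unitary representation `π` if
`sup_{s ∈ Q} ‖π(s) ξ i - ξ i‖ → 0` for every compact subset `Q` of the group. -/
def UnitaryRep.IsAlmostInvariant {G : Type*} [Group G] [TopologicalSpace G] {E : Type*}
    [NormedAddCommGroup E] [InnerProductSpace ℂ E] [CompleteSpace E] (π : UnitaryRep G E)
    {ι : Type*} [Preorder ι] (ξ : ι → E) : Prop :=
  ∀ Q : Set G, IsCompact Q →
    ∀ ε : ℝ, 0 < ε → ∀ᶠ i in atTop, ∀ s ∈ Q, ‖π.op s (ξ i) - ξ i‖ < ε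

/-- Kazhdan's Property (T) for a pair `(G, H)`: every unitary representation of `G` with an almost
invariant net of unit vectors has a nonzero `H`-invariant vector. Hilbert spaces and index sets in
the universe of `G` suffice: given one vector for each pair of a compact subset of `G` and a natural
number, the closed invariant subspace that these vectors generate has a copy in that universe. -/
def KazhdanPairPropertyT (G : Type u) [Group G] [TopologicalSpace G] (H : Subgroup G) : Prop :=
  ∀ (E : Type u) [NormedAddCommGroup E] [InnerProductSpace ℂ E] [CompleteSpace E]
    (π : UnitaryRep G E) (ι : Type u) [Preorder ι] [IsDirectedOrder ι] [Nonempty ι]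
    (ξ : ι → E), (∀ i, ‖ξ i‖ = 1) → π.IsAlmostInvariant ξ →
      ∃ η : E, η ≠ 0 ∧ ∀ h ∈ H, π.op h η = η

/-- Kazhdan's Property (T) for `G`, that is, for the pair `(G, G)`. -/
def KazhdanPropertyT (G : Type u) [Group G] [TopologicalSpace G] : Prop :=
  KazhdanPairPropertyT G ⊤

variable {G : Type u} [Group G] [TopologicalSpace G] [IsTopologicalGroup G] [LocallyCompactSpace G]
  [T2Space G] [MeasurableSpace G] [BorelSpace G]

/-- The inclusion of a subgroup as a continuous homomorphism. -/
def subgroupIncl (H : Subgroup G) : H →ₜ* G where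
  toMonoidHom := H.subtype
  continuous_toFun := continuous_subtype_val

/-- The canonical image of `C*(H)` in `M(C*(G))`, for a closed subgroup `H` of `G`. Being the range
of a *-homomorphism of C*-algebras, it is closed. -/
def subgroupImage (H : Subgroup G) (hH : IsClosed (H : Set G)) :
    NonUnitalStarSubalgebra ℂ 𝓜(ℂ, GroupCStar G) :=
  haveI : LocallyCompactSpace H := hH.isClosedEmbedding_subtypeVal.locallyCompactSpace
  NonUnitalStarAlgHom.range (toMultiplier (subgroupIncl H))

end PropertyT

end

end KazhdanT

/-! Unitary representations of `G` and bimodules over `C*(G)` determine one another closely enough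
to transport both almost invariant nets and fixed vectors.

From bimodules to representations: `G` embeds in the multiplier algebra by unitaries, so it acts on
a bimodule by `ξ ↦ g · ξ · g⁻¹` (`conjRep`). The embedding is strictly continuous, hence compact
subsets of `G` become strictly compact sets of multipliers, and an almost central net is almost
invariant for `conjRep`. The vectors central for the image of `C*(K)`, along `φ : K → G`, are
exactly the vectors fixed by `φ(K)`: `C_c(K)` acts on either side by integrating the action of group
elements, and a continuous function annihilated by all of `C_c(K)` is zero
(`mem_centralVectors_range_toMultiplier`).

From representations to bimodules: a representation `π` gives a left action of `C*(G)`, and the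
trivial representation, which acts by scalars, serves as the right action (`bimodule`). Its
`conjRep` is `π` again. An almost invariant net is almost central there, because a strictly compact
set `L` is norm bounded and `L a` is norm compact for each `a`
(`IsAlmostInvariant.isAlmostCentral`).

Together these give the equivalence for every continuous homomorphism `φ`; inclusions of closed
subgroups and the identity of `G` are special cases. Strong Property (T) follows by applying
Property (T) of `G` to the orthogonal complement of the fixed vectors, where no nonzero vector is
fixed. -/

namespace KazhdanT

noncomputable section

/-! ### Continuous functions tested against `C_c(G)`. -/

section Vanishing

variable {G : Type*} [Group G] [TopologicalSpace G] [IsTopologicalGroup G] [LocallyCompactSpace G]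
  [MeasurableSpace G] [BorelSpace G]
  {E : Type*} [NormedAddCommGroup E] [InnerProductSpace ℂ E] [CompleteSpace E]

/-- A continuous function that is annihilated by all compactly supported continuous functions
vanishes. -/
theorem eq_zero_of_forall_integral_smul_eq_zero {F : G → E} (hF : Continuous F)
    (h : ∀ f : C_c(G, ℂ), ∫ x, f x • F x ∂(Measure.haar : Measure G) = 0) (x₀ : G) :
    F x₀ = 0 := by
  by_contra hx
  obtain ⟨⟨b, b_cont⟩, b_comp, b_nonneg, b_ne⟩ :
    ∃ b : C(G, ℝ), HasCompactSupport b ∧ 0 ≤ b ∧ b x₀ ≠ 0 := exists_continuous_nonneg_pos x₀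
  let c : G → ℂ := fun x => inner ℂ (F x₀) (F x)
  have hc : Continuous c := continuous_const.inner hF
  -- With this test function, pairing `∫ f • F` with `F x₀` gives `∫ b |c|²`, whose integrand is
  -- nonnegative and positive at `x₀`, where `c x₀ = ‖F x₀‖²`.
  obtain ⟨f, hf⟩ : ∃ f : C_c(G, ℂ), ∀ x, f x = (b x : ℂ) * star (c x) :=
    ⟨⟨⟨fun x => (b x : ℂ) * star (c x),
      (Complex.continuous_ofReal.comp b_cont).mul (continuous_star.comp hc)⟩,
      HasCompactSupport.mul_right
        (HasCompactSupport.comp_left (g := fun r : ℝ => (r : ℂ)) b_comp Complex.ofReal_zero)⟩,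
      fun _ => rfl⟩
  have hint : Integrable (fun x => f x • F x) (Measure.haar : Measure G) :=
    (f.continuous_toFun.smul hF).integrable_of_hasCompactSupport f.hasCompactSupport.smul_right
  have h1 : ((∫ x, b x * ‖c x‖ ^ 2 ∂(Measure.haar : Measure G) : ℝ) : ℂ) = 0 := by
    rw [← integral_complex_ofReal, ← inner_zero_right (𝕜 := ℂ) (F x₀), ← h f,
      ← integral_inner hint]
    refine integral_congr_ae (Eventually.of_forall fun x => ?_)
    have h2 : star (c x) * c x = ((‖c x‖ ^ 2 : ℝ) : ℂ) := by
      rw [Complex.ofReal_pow]; exact Complex.conj_mul' (c x)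
    beta_reduce
    rw [inner_smul_right, hf, mul_assoc, h2, Complex.ofReal_mul]
  rw [Complex.ofReal_eq_zero] at h1
  have hpos : Continuous fun x => b x * ‖c x‖ ^ 2 := b_cont.mul (hc.norm.pow 2)
  refine (hpos.integral_pos_of_hasCompactSupport_nonneg_nonzero
    (HasCompactSupport.mul_right b_comp)
    (fun x => mul_nonneg (b_nonneg x) (by positivity)) (x := x₀) ?_).ne' h1
  refine mul_ne_zero b_ne (pow_ne_zero _ (norm_ne_zero_iff.2 ?_))
  exact inner_self_ne_zero.2 hx

/-- Otherwise, by rescaling, every integral would vanish, and the constant function `1` would be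
annihilated by `C_c(G)`. Such an `f` acts as the identity in every trivial representation. -/
theorem exists_integral_eq_one :
    ∃ f : C_c(G, ℂ), ∫ x, f x ∂(Measure.haar : Measure G) = 1 := by
  by_contra! hne
  have h0 (f : C_c(G, ℂ)) : ∫ x, f x • (1 : ℂ) ∂(Measure.haar : Measure G) = 0 := by
    by_contra hf
    refine hne ((∫ x, f x ∂(Measure.haar : Measure G))⁻¹ • f) ?_
    simp only [smul_eq_mul, mul_one] at hf
    simp only [CompactlySupportedContinuousMap.smul_apply]
    rw [MeasureTheory.integral_smul, smul_eq_mul, inv_mul_cancel₀ hf]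
  exact one_ne_zero (eq_zero_of_forall_integral_smul_eq_zero continuous_const h0 1)

end Vanishing

/-! ### The canonical map from `G` to the multipliers of `C*(G)`. -/

section Translation

variable {G : Type u} [Group G] [TopologicalSpace G] [IsTopologicalGroup G] [LocallyCompactSpace G]
  [T2Space G] [MeasurableSpace G] [BorelSpace G]
  {K : Type u} [Group K] [TopologicalSpace K] [IsTopologicalGroup K] [LocallyCompactSpace K]
  [T2Space K] [MeasurableSpace K] [BorelSpace K]

/-- The left translate `x ↦ a (g⁻¹ x)`. -/
def translate (g : G) (a : C_c(G, ℂ)) : C_c(G, ℂ) where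
  toFun x := a (g⁻¹ * x)
  continuous_toFun := a.continuous_toFun.comp (continuous_const.mul continuous_id)
  hasCompactSupport' := a.hasCompactSupport.comp_homeomorph (Homeomorph.mulLeft g⁻¹)

theorem translate_apply (g : G) (a : C_c(G, ℂ)) (x : G) : translate g a x = a (g⁻¹ * x) := rfl

theorem integral_translate {E : Type*} [NormedAddCommGroup E] [InnerProductSpace ℂ E]
    [CompleteSpace E] (π : UnitaryRep G E) (g : G) (a : C_c(G, ℂ)) :
    π.integral (translate g a) = π.op g * π.integral a := by
  ext ξ
  change _ = π.op g (π.integral a ξ)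
  rw [UnitaryRep.integral_apply, UnitaryRep.integral_apply, ← integral_mul_left_eq_self _ g,
    ← ContinuousLinearMap.integral_comp_comm _ (π.integrable_smul_op a ξ)]
  refine integral_congr_ae (Eventually.of_forall fun x => ?_)
  simp [UnitaryRep.op_mul, translate_apply]

theorem norm_op_le {E : Type*} [NormedAddCommGroup E] [InnerProductSpace ℂ E]
    [CompleteSpace E] (π : UnitaryRep G E) (g : G) : ‖π.op g‖ ≤ 1 :=
  ContinuousLinearMap.opNorm_le_bound _ zero_le_one fun ξ => by
    rw [π.norm_op_apply, one_mul]

/-- Left translation by `g` on `C*(G)`. -/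
def transL (g : G) : GroupCStar G →L[ℂ] GroupCStar G :=
  (LinearMap.mkContinuous
    ({ toFun := fun a => ofCc (translate g a)
       map_add' := fun a b => map_add ofCcL (translate g a : GroupAlg G) (translate g b)
       map_smul' := fun c a => map_smul ofCcL c (translate g a : GroupAlg G) } :
       GroupAlg G →ₗ[ℂ] GroupCStar G) 1
    (fun a => GroupCStar.norm_le_of_rep (mul_nonneg zero_le_one (norm_nonneg _))
      fun E _ _ _ π => by
        refine (congrArg norm ((π.lift_ofCc _).trans (integral_translate π g a))).trans_le ?_
        exact (norm_mul_le _ _).trans (mul_le_mul (norm_op_le π g)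
          (norm_integral_le_maxNorm π a) (norm_nonneg _) zero_le_one))).extend ofCcL

theorem transL_ofCc (g : G) (a : C_c(G, ℂ)) : transL g (ofCc a) = ofCc (translate g a) :=
  ContinuousLinearMap.extend_eq _ denseRange_ofCcL isUniformInducing_ofCcL _

theorem lift_transL {E : Type u} [NormedAddCommGroup E] [InnerProductSpace ℂ E] [CompleteSpace E]
    (π : UnitaryRep G E) (g : G) (y : GroupCStar G) :
    π.lift (transL g y) = π.op g * π.lift y := by
  refine GroupCStar.induction (p := fun y => π.lift (transL g y) = π.op g * π.lift y) y
    (isClosed_eq (by fun_prop) (by fun_prop)) fun a => ?_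
  rw [transL_ofCc, π.lift_ofCc, π.lift_ofCc, integral_translate]

theorem norm_transL_apply_le (g : G) (y : GroupCStar G) : ‖transL g y‖ ≤ ‖y‖ :=
  GroupCStar.norm_le_of_rep (norm_nonneg _) fun E _ _ _ π => by
    rw [lift_transL]
    exact (norm_mul_le _ _).trans ((mul_le_mul (norm_op_le π g) (π.norm_lift_le y)
      (norm_nonneg _) zero_le_one).trans_eq (one_mul _))

theorem norm_ofCc_le (f : C_c(G, ℂ)) : ‖ofCc f‖ ≤ ∫ x, ‖f x‖ ∂(Measure.haar : Measure G) := by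
  rw [norm_ofCc]
  exact maxNorm_le (integral_nonneg fun _ => norm_nonneg _) fun E _ _ _ π => π.norm_integral_le f

/-- For `g` in a compact neighbourhood `V` of `g₀` the integrands all vanish outside the compact set
`V · tsupport a`, so the integral depends continuously on `g`. -/
theorem tendsto_integral_norm_translate_sub (a : C_c(G, ℂ)) (g₀ : G) :
    Tendsto (fun g => ∫ x, ‖a (g⁻¹ * x) - a (g₀⁻¹ * x)‖ ∂(Measure.haar : Measure G)) (𝓝 g₀)
      (𝓝 0) := by
  obtain ⟨V, hV, hg⟩ := exists_compact_mem_nhds g₀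
  have hS : IsCompact ((fun p : G × G => p.1 * p.2) '' (V ×ˢ tsupport a)) :=
    (hV.prod a.hasCompactSupport.isCompact).image continuous_mul
  have hsupp (g : G) (hgV : g ∈ V) (x : G)
      (hx : x ∉ (fun p : G × G => p.1 * p.2) '' (V ×ˢ tsupport a)) : a (g⁻¹ * x) = 0 := by
    refine image_eq_zero_of_notMem_tsupport fun h => hx ⟨(g, g⁻¹ * x), ⟨hgV, h⟩, by simp⟩
  have hcont : ContinuousOn
      (fun g => ∫ x, ‖a (g⁻¹ * x) - a (g₀⁻¹ * x)‖ ∂(Measure.haar : Measure G)) V := by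
    refine continuousOn_integral_of_compact_support hS (Continuous.continuousOn ?_) ?_
    · have ha : Continuous a := a.continuous_toFun
      change Continuous fun p : G × G => ‖a (p.1⁻¹ * p.2) - a (g₀⁻¹ * p.2)‖
      fun_prop
    · intro g x hgV hx
      rw [hsupp g hgV x hx, hsupp g₀ (mem_of_mem_nhds hg) x hx, sub_zero, norm_zero]
  simpa using (hcont.continuousAt hg).tendsto

/-- The norm of `C*(G)` is dominated by the `L¹` norm, which settles the dense subspace `C_c(G)`.
Translations are contractions, so an `ε/3` argument extends this to all of `C*(G)`. -/
theorem continuous_transL_apply (y : GroupCStar G) : Continuous fun g : G => transL g y := by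
  refine continuous_iff_continuousAt.2 fun g₀ => Metric.tendsto_nhds.2 fun ε hε => ?_
  obtain ⟨a, ha⟩ : ∃ a : C_c(G, ℂ), dist y (ofCc a) < ε / 3 :=
    denseRange_ofCcL.exists_dist_lt y (by positivity)
  rw [dist_eq_norm] at ha
  filter_upwards [(tendsto_integral_norm_translate_sub a g₀).eventually_lt_const
    (show 0 < ε / 3 by positivity)] with g hg
  have h1 : ‖ofCc (translate g a) - ofCc (translate g₀ a)‖ < ε / 3 := by
    have h2 : ofCc (translate g a) - ofCc (translate g₀ a) =
        ofCc (translate g a - translate g₀ a) :=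
      (map_sub ofCcL (translate g a : GroupAlg G) (translate g₀ a)).symm
    rw [h2]
    exact (norm_ofCc_le _).trans_lt hg
  have h3 : transL g y - transL g₀ y = transL g (y - ofCc a) - transL g₀ (y - ofCc a) +
      (ofCc (translate g a) - ofCc (translate g₀ a)) := by
    rw [map_sub, map_sub, transL_ofCc, transL_ofCc]; abel
  rw [dist_eq_norm, h3]
  refine (norm_add_le _ _).trans_lt ?_
  have h4 := norm_sub_le (transL g (y - ofCc a)) (transL g₀ (y - ofCc a))
  have h5 := norm_transL_apply_le g (y - ofCc a)
  have h6 := norm_transL_apply_le g₀ (y - ofCc a)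
  linarith

/-- The canonical image in `M(C*(G))` of an element of the group `G`. -/
def groupMultiplier (g : G) : 𝓜(ℂ, GroupCStar G) where
  fst := transL g
  -- Right multiplication by `g` is `y ↦ (g⁻¹ y*)*`; passing through the involution avoids right
  -- translates and their modular factor.
  snd := (((starₗᵢ ℂ : GroupCStar G ≃ₗᵢ⋆[ℂ] GroupCStar G) :
    GroupCStar G →L⋆[ℂ] GroupCStar G).comp (transL g⁻¹)).comp
    ((starₗᵢ ℂ : GroupCStar G ≃ₗᵢ⋆[ℂ] GroupCStar G) : GroupCStar G →L⋆[ℂ] GroupCStar G)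
  central := fun y z => GroupCStar.ext_rep fun E _ _ _ π => by
    change π.lift (star (transL g⁻¹ (star y)) * z) = π.lift (y * transL g z)
    rw [π.lift_mul, π.lift_mul, π.lift_star, lift_transL, lift_transL, star_mul, π.lift_star,
      star_star, π.star_op, inv_inv, mul_assoc]

theorem groupMultiplier_snd (g : G) (y : GroupCStar G) :
    (groupMultiplier g).snd y = star (transL g⁻¹ (star y)) := rfl

theorem groupMultiplier_mul (g h : G) :
    groupMultiplier (g * h) = groupMultiplier g * groupMultiplier h := by
  ext y
  · refine GroupCStar.ext_rep fun E _ _ _ π => ?_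
    change π.lift (transL (g * h) y) = π.lift (transL g (transL h y))
    simp only [lift_transL, π.op_mul, mul_assoc]
  · refine GroupCStar.ext_rep fun E _ _ _ π => ?_
    change π.lift (star (transL (g * h)⁻¹ (star y))) =
      π.lift (star (transL h⁻¹ (star (star (transL g⁻¹ (star y))))))
    simp only [lift_transL, π.op_mul, mul_assoc, mul_inv_rev, star_star, π.lift_star]

theorem groupMultiplier_one : groupMultiplier (1 : G) = 1 := by
  ext y
  · refine GroupCStar.ext_rep fun E _ _ _ π => ?_
    change π.lift (transL 1 y) = π.lift y
    rw [lift_transL, π.op_one, one_mul]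
  · refine GroupCStar.ext_rep fun E _ _ _ π => ?_
    change π.lift (star (transL 1⁻¹ (star y))) = π.lift y
    rw [π.lift_star, lift_transL, inv_one, π.op_one, one_mul, π.lift_star, star_star]

theorem star_groupMultiplier (g : G) : star (groupMultiplier g) = groupMultiplier g⁻¹ := by
  ext y
  · rw [DoubleCentralizer.star_fst, groupMultiplier_snd, star_star, star_star]; rfl
  · rw [DoubleCentralizer.star_snd, groupMultiplier_snd, inv_inv]; rfl

theorem continuous_groupMultiplier_fst (y : GroupCStar G) :
    Continuous fun g : G => (groupMultiplier g).fst y := continuous_transL_apply y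

theorem continuous_groupMultiplier_snd (y : GroupCStar G) :
    Continuous fun g : G => (groupMultiplier g).snd y :=
  continuous_star.comp ((continuous_transL_apply (star y)).comp continuous_inv)

/-- This is what makes compact subsets of `G` strictly compact in the multiplier algebra, and so
lets almost centrality be tested on group elements. -/
theorem continuous_groupMultiplier :
    Continuous[_, strictTopology (GroupCStar G)] (groupMultiplier : G → 𝓜(ℂ, GroupCStar G)) := by
  refine continuous_iInf_rng.2 fun y => ?_
  refine continuous_inf_rng (t₂ := TopologicalSpace.induced _ _)
    (t₃ := TopologicalSpace.induced _ _) |>.2 ⟨?_, ?_⟩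
  · exact continuous_induced_rng.2 (continuous_groupMultiplier_fst y)
  · exact continuous_induced_rng.2 (continuous_groupMultiplier_snd y)

section

variable {E : Type u} [NormedAddCommGroup E] [InnerProductSpace ℂ E] [CompleteSpace E]

theorem lift_groupMultiplier_snd (π : UnitaryRep G E) (g : G) (y : GroupCStar G) :
    π.lift ((groupMultiplier g).snd y) = π.lift y * π.op g := by
  rw [groupMultiplier_snd, π.lift_star, lift_transL, star_mul, π.lift_star, star_star, π.star_op,
    inv_inv]

theorem lift_toMultiplier_snd (π : UnitaryRep G E) (φ : K →ₜ* G) (x : GroupCStar K)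
    (y : GroupCStar G) :
    π.lift ((toMultiplier φ x).snd y) = π.lift y * (π.comp φ).lift x := by
  change π.lift (star (convL φ (star x) (star y))) = _
  rw [π.lift_star, lift_convL, UnitaryRep.lift_star, π.lift_star, star_mul, star_star, star_star]

end

theorem integrable_smul_of_continuous {F : Type*} [NormedAddCommGroup F] [NormedSpace ℂ F]
    (f : C_c(K, ℂ)) {k : K → F} (hk : Continuous k) :
    Integrable (fun x => f x • k x) (Measure.haar : Measure K) :=
  (f.continuous_toFun.smul hk).integrable_of_hasCompactSupport f.hasCompactSupport.smul_right

/-- The translates of `y` are norm continuous, so the right side is a Bochner integral in `C*(G)`.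
Unitary representations separate the points of `C*(G)`, and in each of them both sides become the
integrated form of `π ∘ φ` applied to the vector `π(y) ξ`. -/
theorem toMultiplier_fst_eq_integral (φ : K →ₜ* G) (f : C_c(K, ℂ)) (y : GroupCStar G) :
    (toMultiplier φ (ofCc f)).fst y =
      ∫ k, f k • (groupMultiplier (φ k)).fst y ∂(Measure.haar : Measure K) := by
  have hi := integrable_smul_of_continuous f
    ((continuous_groupMultiplier_fst y).comp φ.continuous_toFun)
  refine GroupCStar.ext_rep fun E _ _ _ π => ?_
  ext ξ
  have h := (((ContinuousLinearMap.apply ℂ E ξ).comp π.lift).integral_comp_comm hi)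
  refine Eq.trans ?_ h
  change π.lift (convL φ (ofCc f) y) ξ = _
  rw [lift_convL, UnitaryRep.lift_ofCc]
  change (π.comp φ).integral f (π.lift y ξ) = _
  rw [UnitaryRep.integral_apply]
  refine integral_congr_ae (Eventually.of_forall fun k => ?_)
  change _ = π.lift (f k • transL (φ k) y) ξ
  rw [map_smul, lift_transL]; rfl

theorem toMultiplier_snd_eq_integral (φ : K →ₜ* G) (f : C_c(K, ℂ)) (y : GroupCStar G) :
    (toMultiplier φ (ofCc f)).snd y =
      ∫ k, f k • (groupMultiplier (φ k)).snd y ∂(Measure.haar : Measure K) := by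
  have hi := integrable_smul_of_continuous f
    ((continuous_groupMultiplier_snd y).comp φ.continuous_toFun)
  refine GroupCStar.ext_rep fun E _ _ _ π => ?_
  ext ξ
  have h := (((ContinuousLinearMap.apply ℂ E ξ).comp π.lift).integral_comp_comm hi)
  refine Eq.trans ?_ h
  rw [lift_toMultiplier_snd, UnitaryRep.lift_ofCc]
  change π.lift y ((π.comp φ).integral f ξ) = _
  rw [UnitaryRep.integral_apply,
    ← ContinuousLinearMap.integral_comp_comm _ ((π.comp φ).integrable_smul_op f ξ)]
  refine integral_congr_ae (Eventually.of_forall fun k => ?_)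
  change _ = π.lift (f k • (groupMultiplier (φ k)).snd y) ξ
  rw [map_smul, lift_groupMultiplier_snd]
  exact map_smul (π.lift y) _ _

/-- Identifies the pair attached to the identity of `G` with the pair of `C*(G)` and itself, so that
the absolute case follows from the relative one. -/
theorem toMultiplier_id (x : GroupCStar G) :
    toMultiplier (ContinuousMonoidHom.id G) x = (x : 𝓜(ℂ, GroupCStar G)) := by
  ext y
  · rfl
  · refine GroupCStar.ext_rep fun E _ _ _ π => ?_
    rw [lift_toMultiplier_snd]
    change _ = π.lift (y * x)
    rw [π.lift_mul]; rfl

theorem range_toMultiplier_id :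
    NonUnitalStarAlgHom.range (toMultiplier (ContinuousMonoidHom.id G)) =
      selfImage (GroupCStar G) := by
  ext b
  simp only [selfImage, NonUnitalStarAlgHom.mem_range, toMultiplier_id]
  rfl

end Translation

/-! ### Extending multipliers through a non-degenerate representation. -/

section Extension

variable {A : Type*} [NonUnitalCStarAlgebra A]
  {E : Type*} [NormedAddCommGroup E] [InnerProductSpace ℂ E] [CompleteSpace E]
  {ρ : A →⋆ₙₐ[ℂ] (E →L[ℂ] E)}

theorem IsNondegenerate.induction (hρ : IsNondegenerate ρ) {S : Submodule ℂ E}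
    (hS : IsClosed (S : Set E)) (h : ∀ a ξ, ρ a ξ ∈ S) (ξ : E) : ξ ∈ S := by
  have h1 : Submodule.span ℂ {η : E | ∃ (a : A) (ξ : E), ρ a ξ = η} ≤ S := by
    rw [Submodule.span_le]
    rintro _ ⟨a, ξ, rfl⟩
    exact h a ξ
  have h2 := Submodule.topologicalClosure_minimal _ h1 hS
  rw [show _ = _ from hρ] at h2
  exact h2 trivial

theorem IsNondegenerate.ext (hρ : IsNondegenerate ρ) {S T : E →L[ℂ] E}
    (h : ∀ a ξ, S (ρ a ξ) = T (ρ a ξ)) : S = T := by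
  ext ξ
  exact hρ.induction (S := LinearMap.eqLocus (S : E →ₗ[ℂ] E) (T : E →ₗ[ℂ] E))
    (isClosed_eq S.continuous T.continuous) h ξ

/-- On the dense span of the vectors `ρ a ξ` this is the approximate unit estimate `norm_lsum_le`.
-/
theorem IsNondegenerate.norm_extension_le (hρ : IsNondegenerate ρ) (L : A →L[ℂ] A)
    (hL : ∀ a b, L (a * b) = L a * b) {T : E →L[ℂ] E} (hT : ∀ a ξ, T (ρ a ξ) = ρ (L a) ξ) :
    ‖T‖ ≤ ‖L‖ := by
  refine ContinuousLinearMap.opNorm_le_bound _ (norm_nonneg _) fun ξ => ?_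
  refine hρ.denseRange.induction_on (p := fun ξ => ‖T ξ‖ ≤ ‖L‖ * ‖ξ‖) ξ
    (isClosed_le (by fun_prop) (by fun_prop)) fun z => ?_
  refine le_trans (le_of_eq (congrArg norm ?_)) (norm_lsum_le ρ L hL z)
  simp only [Finsupp.lsum_apply, Finsupp.sum, map_sum]
  exact Finset.sum_congr rfl fun a _ => hT a (z a)

/-- The hypothesis `hL` says that `L'` is adjoint to `L` for the `A`-valued pairing `(b, a) ↦ b* a`.
Non-degeneracy, used in both arguments of the inner product, carries this over to `T` and `T'`. -/
theorem IsNondegenerate.star_extension (hρ : IsNondegenerate ρ) {L L' : A → A}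
    (hL : ∀ a b, star (L b) * a = star b * L' a) {T T' : E →L[ℂ] E}
    (hT : ∀ a ξ, T (ρ a ξ) = ρ (L a) ξ) (hT' : ∀ a ξ, T' (ρ a ξ) = ρ (L' a) ξ) :
    star T = T' := by
  have hadj (a : A) (ξ η : E) : inner ℂ (ρ a ξ) η = inner ℂ ξ (ρ (star a) η) := by
    rw [map_star, ContinuousLinearMap.star_eq_adjoint, ContinuousLinearMap.adjoint_inner_right]
  refine hρ.ext fun a ξ => ext_inner_left ℂ fun ζ => ?_
  rw [ContinuousLinearMap.star_eq_adjoint, ContinuousLinearMap.adjoint_inner_right, hT']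
  have h : inner ℂ (ρ a ξ) (T ζ) = inner ℂ (ρ (L' a) ξ) ζ := by
    -- Both sides are continuous and linear in `ζ`, so `ζ` may be taken of the form `ρ b η`.
    refine hρ.induction (S := LinearMap.eqLocus
      ((innerSL ℂ (ρ a ξ) : E →L[ℂ] ℂ) ∘SL T : E →ₗ[ℂ] ℂ) (innerSL ℂ (ρ (L' a) ξ) : E →ₗ[ℂ] ℂ))
      (isClosed_eq ((innerSL ℂ (ρ a ξ)) ∘SL T).continuous (innerSL ℂ (ρ (L' a) ξ)).continuous)
      (fun b η => ?_) ζ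
    change inner ℂ (ρ a ξ) (T (ρ b η)) = inner ℂ (ρ (L' a) ξ) (ρ b η)
    rw [hT, ← inner_conj_symm, ← inner_conj_symm (ρ (L' a) ξ), hadj, hadj]
    congr 2
    change (ρ (star (L b)) * ρ a) ξ = (ρ (star b) * ρ (L' a)) ξ
    rw [← map_mul, ← map_mul, hL]
  rw [← inner_conj_symm, h, inner_conj_symm]

theorem IsNondegenerate.commute_extension (hρ : IsNondegenerate ρ) {L : A → A} {S T : E →L[ℂ] E}
    (hT : ∀ a ξ, T (ρ a ξ) = ρ (L a) ξ) (hS : ∀ a, Commute S (ρ a)) : Commute S T := by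
  have h (a : A) (ξ : E) : S (ρ a ξ) = ρ a (S ξ) := congrArg (fun U => U ξ) (hS a)
  refine hρ.ext fun a ξ => ?_
  change S (T (ρ a ξ)) = T (S (ρ a ξ))
  rw [hT, h, h, hT]

theorem continuous_apply_of_mem_closure {X : Type*} [TopologicalSpace X] {T : X → E →L[ℂ] E}
    (hT : ∀ x, ‖T x‖ ≤ 1) {s : Set E} (hs : ∀ ξ ∈ s, Continuous fun x => T x ξ) {ξ : E}
    (hξ : ξ ∈ closure s) : Continuous fun x => T x ξ := by
  refine continuous_of_uniform_approx_of_continuous fun U hU => ?_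
  obtain ⟨ε, hε, hεU⟩ := Metric.mem_uniformity_dist.1 hU
  obtain ⟨η, hη, h⟩ := Metric.mem_closure_iff.1 hξ ε hε
  refine ⟨fun x => T x η, hs η hη, fun x => hεU ?_⟩
  rw [dist_eq_norm, ← map_sub]
  refine ((T x).le_of_opNorm_le (hT x) _).trans_lt ?_
  rwa [one_mul, ← dist_eq_norm]

/-- Pointwise norm continuity on `A` turns into strong operator continuity. The vectors with
continuous orbit form a subspace, closed because the `T x` are contractions, and it contains every
`ρ a η`. -/
theorem IsNondegenerate.continuous_extension (hρ : IsNondegenerate ρ) {X : Type*}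
    [TopologicalSpace X] {T : X → E →L[ℂ] E} (hT1 : ∀ x, ‖T x‖ ≤ 1) {L : X → A → A}
    (hT : ∀ x a ξ, T x (ρ a ξ) = ρ (L x a) ξ) (hL : ∀ a, Continuous fun x => L x a) (ξ : E) :
    Continuous fun x => T x ξ := by
  let S : Submodule ℂ E :=
    { carrier := {ξ | Continuous fun x => T x ξ}
      add_mem' := fun {ξ η} (hξ : Continuous fun x => T x ξ) (hη : Continuous fun x => T x η) => by
        simp only [Set.mem_ofPred_eq, map_add]; exact hξ.add hη
      zero_mem' := by simpa only [Set.mem_ofPred_eq, map_zero] using continuous_const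
      smul_mem' := fun c ξ (hξ : Continuous fun x => T x ξ) => by
        simp only [Set.mem_ofPred_eq, map_smul]; exact hξ.const_smul c }
  refine hρ.induction (S := S) ?_ (fun a η => ?_) ξ
  · exact isClosed_of_closure_subset fun η hη =>
      continuous_apply_of_mem_closure hT1 (fun _ h => h) hη
  · have hρc : Continuous ρ := AddMonoidHomClass.continuous_of_bound ρ 1 fun a => by
      rw [one_mul]
      exact NonUnitalStarAlgHom.norm_apply_le ρ a
    change Continuous fun x => T x (ρ a η)
    simp only [hT]
    exact (hρc.comp (hL a)).clm_apply continuous_const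

/-- The orbit map `a ↦ ρ a ξ`. -/
def orbitL (ρ : A →⋆ₙₐ[ℂ] (E →L[ℂ] E)) (ξ : E) : A →L[ℂ] E :=
  LinearMap.mkContinuous
    { toFun := fun a => ρ a ξ
      map_add' := fun a b => by rw [map_add]; rfl
      map_smul' := fun c a => by rw [map_smul]; rfl } ‖ξ‖
    fun a => by
      rw [mul_comm]
      exact (ρ a).le_of_opNorm_le (NonUnitalStarAlgHom.norm_apply_le ρ a) ξ

theorem orbitL_apply (ρ : A →⋆ₙₐ[ℂ] (E →L[ℂ] E)) (ξ : E) (a : A) : orbitL ρ ξ a = ρ a ξ := rfl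

section Integral

variable {K : Type*} [Group K] [TopologicalSpace K] [IsTopologicalGroup K] [LocallyCompactSpace K]
  [MeasurableSpace K] [BorelSpace K]

/-- `T` need not be norm continuous, so the integral is taken vector by vector; the result is
bounded by the `L¹` norm of `f`. -/
theorem exists_strong_integral (f : C_c(K, ℂ)) {T : K → E →L[ℂ] E} (hT1 : ∀ k, ‖T k‖ ≤ 1)
    (hT : ∀ ξ, Continuous fun k => T k ξ) :
    ∃ S : E →L[ℂ] E, ∀ ξ, S ξ = ∫ k, f k • T k ξ ∂(Measure.haar : Measure K) := by
  have hi (ξ : E) : Integrable (fun k => f k • T k ξ) (Measure.haar : Measure K) :=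
    (f.continuous_toFun.smul (hT ξ)).integrable_of_hasCompactSupport f.hasCompactSupport.smul_right
  have hf : Integrable (fun k => f k) (Measure.haar : Measure K) :=
    f.continuous_toFun.integrable_of_hasCompactSupport f.hasCompactSupport
  refine ⟨LinearMap.mkContinuous
    { toFun := fun ξ => ∫ k, f k • T k ξ ∂(Measure.haar : Measure K)
      map_add' := fun ξ η => by
        simp only [map_add, smul_add]
        exact integral_add (hi ξ) (hi η)
      map_smul' := fun c ξ => by
        simp only [map_smul, RingHom.id_apply, smul_comm _ c]
        exact integral_smul c _ }
    (∫ k, ‖f k‖ ∂(Measure.haar : Measure K)) (fun ξ => ?_), fun ξ => rfl⟩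
  refine (norm_integral_le_integral_norm _).trans ?_
  rw [← integral_mul_const]
  refine integral_mono (hi ξ).norm (hf.norm.mul_const _) fun k => ?_
  beta_reduce
  rw [norm_smul]
  refine mul_le_mul_of_nonneg_left ?_ (norm_nonneg _)
  exact ((T k).le_of_opNorm_le (hT1 k) ξ).trans_eq (one_mul _)

/-- Both sides are bounded operators, so they need only be compared on vectors `ρ a η`. There the
orbit map `a ↦ ρ a η` commutes with the integral in `A`. -/
theorem IsNondegenerate.extension_eq_integral (hρ : IsNondegenerate ρ) (f : C_c(K, ℂ))
    {T : K → E →L[ℂ] E} (hT1 : ∀ k, ‖T k‖ ≤ 1) {L : K → A → A}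
    (hT : ∀ k a ξ, T k (ρ a ξ) = ρ (L k a) ξ) (hL : ∀ a, Continuous fun k => L k a)
    {S : E →L[ℂ] E} {L₀ : A → A} (hS : ∀ a ξ, S (ρ a ξ) = ρ (L₀ a) ξ)
    (hL₀ : ∀ a, L₀ a = ∫ k, f k • L k a ∂(Measure.haar : Measure K)) (ξ : E) :
    S ξ = ∫ k, f k • T k ξ ∂(Measure.haar : Measure K) := by
  obtain ⟨S', hS'⟩ := exists_strong_integral f hT1 (hρ.continuous_extension hT1 hT hL)
  rw [← hS']
  congr 1
  refine hρ.ext fun a η => ?_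
  have hi : Integrable (fun k => f k • L k a) (Measure.haar : Measure K) :=
    (f.continuous_toFun.smul (hL a)).integrable_of_hasCompactSupport f.hasCompactSupport.smul_right
  rw [hS, hS', hL₀, ← orbitL_apply, ← (orbitL ρ η).integral_comp_comm hi]
  refine integral_congr_ae (Eventually.of_forall fun k => ?_)
  beta_reduce
  rw [map_smul, hT, orbitL_apply]

end Integral

/-- The unitary representation with operators `T g`, when these extend a group `L g` of unitary
multipliers along a non-degenerate *-representation. -/
def IsNondegenerate.unitaryRep (hρ : IsNondegenerate ρ) {G : Type*} [Group G] [TopologicalSpace G]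
    (L : G → A → A) (T : G → E →L[ℂ] E) (hT : ∀ g a ξ, T g (ρ a ξ) = ρ (L g a) ξ)
    (h_one : ∀ a, L 1 a = a) (h_mul : ∀ g h a, L (g * h) a = L g (L h a))
    (h_star : ∀ g a b, star (L g b) * a = star b * L g⁻¹ a)
    (h_cont : ∀ a, Continuous fun g => L g a) : UnitaryRep G E :=
  have hT1 : T 1 = 1 := hρ.ext fun a ξ => by rw [hT, h_one]; rfl
  have hTm (g h : G) : T (g * h) = T g * T h := hρ.ext fun a ξ => by
    change _ = T g (T h (ρ a ξ))
    rw [hT, hT, hT, h_mul]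
  have hTs (g : G) : star (T g) = T g⁻¹ := hρ.star_extension (h_star g) (hT g) (hT g⁻¹)
  have hTu (g : G) : T g ∈ unitary (E →L[ℂ] E) := Unitary.mem_iff.2 (by
    rw [hTs, ← hTm, ← hTm, inv_mul_cancel, mul_inv_cancel, hT1]; exact ⟨rfl, rfl⟩)
  have hTn (g : G) : ‖T g‖ ≤ 1 := by
    -- The C*-identity gives `‖T g‖² = ‖1‖`; only `‖1‖ ≤ 1` is available, since `E` may be zero.
    have h := CStarRing.norm_star_mul_self (x := T g)
    rw [(Unitary.mem_iff.1 (hTu g)).1] at h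
    nlinarith [norm_nonneg (T g), ContinuousLinearMap.norm_id_le (𝕜 := ℂ) (E := E),
      show ‖(1 : E →L[ℂ] E)‖ = ‖ContinuousLinearMap.id ℂ E‖ from rfl]
  { toHom := MonoidHom.mk' (fun g => ⟨T g, hTu g⟩) fun g h => Subtype.ext (hTm g h)
    continuous_apply := fun ξ => hρ.continuous_extension hTn hT h_cont ξ }

end Extension

namespace HilbertBimodule

/-! ### Multiplier actions on a bimodule. -/

section Multipliers

variable {A : Type*} [NonUnitalCStarAlgebra A]
  {E : Type*} [NormedAddCommGroup E] [InnerProductSpace ℂ E] [CompleteSpace E]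

theorem right_apply_opRight (M : HilbertBimodule A E) (x : 𝓜(ℂ, A)) (a : Aᵐᵒᵖ) (ξ : E) :
    M.rightMul x (M.right a ξ) = M.right (opRight x a) ξ := M.rightMul_right x a.unop ξ

theorem norm_leftMul_le (M : HilbertBimodule A E) (x : 𝓜(ℂ, A)) : ‖M.leftMul x‖ ≤ ‖x‖ := by
  rw [← DoubleCentralizer.norm_fst]
  exact M.left_nondegenerate.norm_extension_le _ (multiplier_fst_mul x) (M.leftMul_left x)

theorem norm_rightMul_le (M : HilbertBimodule A E) (x : 𝓜(ℂ, A)) : ‖M.rightMul x‖ ≤ ‖x‖ := by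
  rw [← DoubleCentralizer.norm_snd]
  refine (M.right_nondegenerate.norm_extension_le _ (opRight_mul x)
    (M.right_apply_opRight x)).trans ?_
  exact ContinuousLinearMap.opNorm_le_bound _ (norm_nonneg _) fun a => x.snd.le_opNorm a.unop

/-- The left action of the multiplier algebra as a continuous linear map. -/
def leftMulL (M : HilbertBimodule A E) : 𝓜(ℂ, A) →L[ℂ] (E →L[ℂ] E) :=
  LinearMap.mkContinuous
    { toFun := M.leftMul
      map_add' := fun x y => (M.leftMul_unique _ _ fun a ξ => by
        rw [_root_.add_apply, leftMul_left, leftMul_left, DoubleCentralizer.add_fst,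
          _root_.add_apply, map_add]; rfl).symm
      map_smul' := fun c x => (M.leftMul_unique _ _ fun a ξ => by
        rw [_root_.smul_apply, leftMul_left, DoubleCentralizer.smul_fst, _root_.smul_apply,
          map_smul]; rfl).symm } 1
    fun x => by rw [one_mul]; exact M.norm_leftMul_le x

/-- The right action of the multiplier algebra as a continuous linear map. -/
def rightMulL (M : HilbertBimodule A E) : 𝓜(ℂ, A) →L[ℂ] (E →L[ℂ] E) :=
  LinearMap.mkContinuous
    { toFun := M.rightMul
      map_add' := fun x y => (M.rightMul_unique _ _ fun a ξ => by
        rw [_root_.add_apply, rightMul_right, rightMul_right, DoubleCentralizer.add_snd,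
          _root_.add_apply, MulOpposite.op_add, map_add]; rfl).symm
      map_smul' := fun c x => (M.rightMul_unique _ _ fun a ξ => by
        rw [_root_.smul_apply, rightMul_right, DoubleCentralizer.smul_snd, _root_.smul_apply,
          MulOpposite.op_smul, map_smul]; rfl).symm } 1
    fun x => by rw [one_mul]; exact M.norm_rightMul_le x

theorem leftMulL_apply (M : HilbertBimodule A E) (x : 𝓜(ℂ, A)) : M.leftMulL x = M.leftMul x := rfl

theorem rightMulL_apply (M : HilbertBimodule A E) (x : 𝓜(ℂ, A)) :
    M.rightMulL x = M.rightMul x := rfl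

/-- An operator commuting with a non-degenerate representation commutes with its extension to
multipliers. This is applied once on each side, starting from the commuting actions of `A`. -/
theorem commute_leftMul_rightMul (M : HilbertBimodule A E) (x y : 𝓜(ℂ, A)) :
    Commute (M.leftMul x) (M.rightMul y) := by
  refine M.right_nondegenerate.commute_extension (M.right_apply_opRight y) fun b => ?_
  refine (M.left_nondegenerate.commute_extension (M.leftMul_left x) fun a => ?_).symm
  ext ξ
  exact (M.left_right_comm a b.unop ξ).symm

end Multipliers

/-! ### The conjugation representation of `G` and its fixed vectors. -/

section Conjugation

variable {G : Type u} [Group G] [TopologicalSpace G] [IsTopologicalGroup G] [LocallyCompactSpace G]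
  [T2Space G] [MeasurableSpace G] [BorelSpace G]
  {K : Type u} [Group K] [TopologicalSpace K] [IsTopologicalGroup K] [LocallyCompactSpace K]
  [T2Space K] [MeasurableSpace K] [BorelSpace K]
  {E : Type*} [NormedAddCommGroup E] [InnerProductSpace ℂ E] [CompleteSpace E]

theorem continuous_opRight_groupMultiplier (a : (GroupCStar G)ᵐᵒᵖ) :
    Continuous fun g : G => opRight (groupMultiplier g) a :=
  MulOpposite.continuous_op.comp (continuous_groupMultiplier_snd a.unop)

/-- The unitary representation `ξ ↦ g · ξ` of `G` on a bimodule over `C*(G)`. -/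
def leftRep (M : HilbertBimodule (GroupCStar G) E) : UnitaryRep G E :=
  M.left_nondegenerate.unitaryRep (fun g a => (groupMultiplier g).fst a)
    (fun g => M.leftMul (groupMultiplier g)) (fun g => M.leftMul_left (groupMultiplier g))
    (fun a => by rw [groupMultiplier_one]; rfl)
    (fun g h a => by rw [groupMultiplier_mul]; rfl)
    -- The adjoint relation is the centrality of the multiplier `g⁻¹`, combined with `star g = g⁻¹`.
    (fun g a b => by
      rw [← (groupMultiplier g⁻¹).central, ← star_groupMultiplier, DoubleCentralizer.star_snd,
        star_star])
    continuous_groupMultiplier_fst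

/-- The unitary representation `ξ ↦ ξ · g⁻¹` of `G` on a bimodule over `C*(G)`. -/
def rightRep (M : HilbertBimodule (GroupCStar G) E) : UnitaryRep G E :=
  M.right_nondegenerate.unitaryRep (fun g a => opRight (groupMultiplier g⁻¹) a)
    (fun g => M.rightMul (groupMultiplier g⁻¹)) (fun g => M.right_apply_opRight _)
    (fun a => by rw [inv_one, groupMultiplier_one]; rfl)
    (fun g h a => by rw [mul_inv_rev, groupMultiplier_mul]; rfl)
    (fun g a b => by
      apply MulOpposite.unop_injective
      change a.unop * star ((groupMultiplier g⁻¹).snd b.unop) =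
        (groupMultiplier g⁻¹⁻¹).snd a.unop * star b.unop
      rw [(groupMultiplier g⁻¹⁻¹).central, ← star_groupMultiplier g⁻¹,
        DoubleCentralizer.star_fst, star_star])
    (fun a => (continuous_opRight_groupMultiplier a).comp continuous_inv)

theorem leftRep_op (M : HilbertBimodule (GroupCStar G) E) (g : G) :
    M.leftRep.op g = M.leftMul (groupMultiplier g) := rfl

theorem rightRep_op (M : HilbertBimodule (GroupCStar G) E) (g : G) :
    M.rightRep.op g = M.rightMul (groupMultiplier g⁻¹) := rfl

theorem commute_leftRep_rightRep (M : HilbertBimodule (GroupCStar G) E) (g h : G) :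
    Commute (M.leftRep.op g) (M.rightRep.op h) :=
  M.commute_leftMul_rightMul _ _

/-- The unitary representation `ξ ↦ g · ξ · g⁻¹` of `G` on a bimodule over `C*(G)`. -/
def conjRep (M : HilbertBimodule (GroupCStar G) E) : UnitaryRep G E where
  toHom := MonoidHom.mk' (fun g => M.leftRep.toHom g * M.rightRep.toHom g) fun g h => by
    apply Subtype.ext
    change M.leftRep.op (g * h) * M.rightRep.op (g * h) =
      M.leftRep.op g * M.rightRep.op g * (M.leftRep.op h * M.rightRep.op h)
    rw [UnitaryRep.op_mul, UnitaryRep.op_mul]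
    exact (M.commute_leftRep_rightRep h g).symm.mul_mul_mul_comm _ _ |>.symm
  continuous_apply ξ := by
    change Continuous fun g => M.leftRep.op g (M.rightRep.op g ξ)
    -- Write `λ`, `ρ` for the left and right representations. As `λ(g)` is isometric, the increment
    -- of `λ(g) ρ(g) ξ` is at most `‖ρ(g) ξ - ρ(g₀) ξ‖ + ‖(λ(g) - λ(g₀)) ρ(g₀) ξ‖`.
    refine continuous_iff_continuousAt.2 fun g₀ => ?_
    rw [ContinuousAt, tendsto_iff_norm_sub_tendsto_zero]
    have h1 := tendsto_iff_norm_sub_tendsto_zero.1 ((M.rightRep.continuous_op ξ).tendsto g₀)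
    have h2 := tendsto_iff_norm_sub_tendsto_zero.1
      ((M.leftRep.continuous_op (M.rightRep.op g₀ ξ)).tendsto g₀)
    refine squeeze_zero (fun _ => norm_nonneg _) (fun g => ?_) (by simpa using h1.add h2)
    rw [← M.leftRep.norm_op_apply g (M.rightRep.op g ξ - M.rightRep.op g₀ ξ), map_sub]
    exact norm_sub_le_norm_sub_add_norm_sub _ _ _

theorem conjRep_op (M : HilbertBimodule (GroupCStar G) E) (g : G) :
    M.conjRep.op g = M.leftRep.op g * M.rightRep.op g := rfl

/-- One has `g · ξ · g⁻¹ - ξ = (g · ξ - ξ · g) · g⁻¹`, and right multiplication by `g⁻¹` is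
isometric. -/
theorem norm_conjRep_op_sub (M : HilbertBimodule (GroupCStar G) E) (g : G) (ξ : E) :
    ‖M.conjRep.op g ξ - ξ‖ =
      ‖M.leftMul (groupMultiplier g) ξ - M.rightMul (groupMultiplier g) ξ‖ := by
  rw [← M.rightRep.norm_op_apply g (M.leftMul (groupMultiplier g) ξ - _), map_sub, conjRep_op,
    (M.commute_leftRep_rightRep g g).eq, leftRep_op]
  have h : M.rightRep.op g (M.rightMul (groupMultiplier g) ξ) = ξ := by
    have h2 : M.rightMul (groupMultiplier g) = M.rightRep.op g⁻¹ := by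
      rw [rightRep_op, inv_inv]
    rw [h2, ← mul_apply_eq_comp, ← UnitaryRep.op_mul, mul_inv_cancel,
      UnitaryRep.op_one]
    rfl
  rw [h]
  rfl

theorem conjRep_op_eq_self_iff (M : HilbertBimodule (GroupCStar G) E) (g : G) (ξ : E) :
    M.conjRep.op g ξ = ξ ↔
      M.leftMul (groupMultiplier g) ξ = M.rightMul (groupMultiplier g) ξ := by
  rw [← sub_eq_zero, ← norm_eq_zero, norm_conjRep_op_sub, norm_eq_zero, sub_eq_zero]

/-- The image of `Q` among the multipliers is strictly compact, and on it the commutator norm equals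
the displacement under `conjRep`. -/
theorem IsAlmostCentral.isAlmostInvariant {M : HilbertBimodule (GroupCStar G) E} {ι : Type*}
    [Preorder ι] {ξ : ι → E} (h : M.IsAlmostCentral ξ) : M.conjRep.IsAlmostInvariant ξ := by
  intro Q hQ ε hε
  have hL : @IsCompact _ (strictTopology (GroupCStar G)) (groupMultiplier '' Q) :=
    let _ := strictTopology (GroupCStar G)
    hQ.image continuous_groupMultiplier
  filter_upwards [h _ hL ε hε] with i hi s hs
  rw [norm_conjRep_op_sub]
  exact hi _ ⟨s, hs, rfl⟩

theorem norm_groupMultiplier_le (g : G) : ‖groupMultiplier g‖ ≤ 1 := by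
  rw [← DoubleCentralizer.norm_fst]
  exact ContinuousLinearMap.opNorm_le_bound _ zero_le_one fun y => by
    rw [one_mul]; exact norm_transL_apply_le g y

theorem continuous_leftMul_groupMultiplier (M : HilbertBimodule (GroupCStar G) E) (ξ : E) :
    Continuous fun g : G => M.leftMul (groupMultiplier g) ξ := M.leftRep.continuous_op ξ

theorem continuous_rightMul_groupMultiplier (M : HilbertBimodule (GroupCStar G) E) (ξ : E) :
    Continuous fun g : G => M.rightMul (groupMultiplier g) ξ := by
  simpa only [Function.comp_def, rightRep_op, inv_inv] using
    (M.rightRep.continuous_op ξ).comp continuous_inv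

theorem leftMul_toMultiplier_ofCc (M : HilbertBimodule (GroupCStar G) E) (φ : K →ₜ* G)
    (f : C_c(K, ℂ)) (ξ : E) :
    M.leftMul (toMultiplier φ (ofCc f)) ξ =
      ∫ k, f k • M.leftMul (groupMultiplier (φ k)) ξ ∂(Measure.haar : Measure K) :=
  M.left_nondegenerate.extension_eq_integral f
    (fun k => (M.norm_leftMul_le _).trans (norm_groupMultiplier_le (φ k)))
    (fun k => M.leftMul_left (groupMultiplier (φ k)))
    (fun a => (continuous_groupMultiplier_fst a).comp φ.continuous_toFun)
    (M.leftMul_left _) (toMultiplier_fst_eq_integral φ f) ξ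

theorem rightMul_toMultiplier_ofCc (M : HilbertBimodule (GroupCStar G) E) (φ : K →ₜ* G)
    (f : C_c(K, ℂ)) (ξ : E) :
    M.rightMul (toMultiplier φ (ofCc f)) ξ =
      ∫ k, f k • M.rightMul (groupMultiplier (φ k)) ξ ∂(Measure.haar : Measure K) := by
  refine M.right_nondegenerate.extension_eq_integral f
    (fun k => (M.norm_rightMul_le _).trans (norm_groupMultiplier_le (φ k)))
    (fun k => M.right_apply_opRight (groupMultiplier (φ k)))
    (fun a => (continuous_opRight_groupMultiplier a).comp φ.continuous_toFun)
    (M.right_apply_opRight _) (fun a => ?_) ξ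
  have hi := integrable_smul_of_continuous f
    ((continuous_groupMultiplier_snd a.unop).comp φ.continuous_toFun)
  refine Eq.trans ?_ ((((MulOpposite.opContinuousLinearEquiv ℂ :
    GroupCStar G ≃L[ℂ] (GroupCStar G)ᵐᵒᵖ) :
    GroupCStar G →L[ℂ] (GroupCStar G)ᵐᵒᵖ).integral_comp_comm hi).symm)
  exact congrArg MulOpposite.op (toMultiplier_snd_eq_integral φ f a.unop)

theorem continuous_toMultiplier (φ : K →ₜ* G) : Continuous (toMultiplier φ) :=
  AddMonoidHomClass.continuous_of_bound (toMultiplier φ) ‖convL φ‖ fun x => by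
    rw [← DoubleCentralizer.norm_fst]
    exact (convL φ).le_opNorm x

/-- If `η` is central, the continuous function `k ↦ φ(k) · η - η · φ(k)` is annihilated by all of
`C_c(K)`, hence vanishes. Conversely, a fixed vector is central for `C_c(K)` by integration, and for
`C*(K)` by density and norm continuity of both actions. -/
theorem mem_centralVectors_range_toMultiplier (M : HilbertBimodule (GroupCStar G) E)
    (φ : K →ₜ* G) {η : E} :
    η ∈ M.centralVectors (NonUnitalStarAlgHom.range (toMultiplier φ)) ↔
      ∀ k, M.conjRep.op (φ k) η = η := by
  simp only [conjRep_op_eq_self_iff]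
  have hl := (M.continuous_leftMul_groupMultiplier η).comp φ.continuous_toFun
  have hr := (M.continuous_rightMul_groupMultiplier η).comp φ.continuous_toFun
  constructor
  · intro h k
    rw [← sub_eq_zero]
    refine eq_zero_of_forall_integral_smul_eq_zero (hl.sub hr) (fun f => ?_) k
    simp only [Pi.sub_apply, smul_sub]
    rw [integral_sub (integrable_smul_of_continuous f hl) (integrable_smul_of_continuous f hr),
      sub_eq_zero]
    exact ((M.leftMul_toMultiplier_ofCc φ f η).symm.trans (h _ ⟨ofCc f, rfl⟩)).trans
      (M.rightMul_toMultiplier_ofCc φ f η)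
  · rintro h _ ⟨x, rfl⟩
    refine GroupCStar.induction
      (p := fun x => M.leftMulL (toMultiplier φ x) η = M.rightMulL (toMultiplier φ x) η) x
      (isClosed_eq ?_ ?_) fun f => ?_
    · exact (M.leftMulL.continuous.comp (continuous_toMultiplier φ)).clm_apply continuous_const
    · exact (M.rightMulL.continuous.comp (continuous_toMultiplier φ)).clm_apply continuous_const
    · rw [leftMulL_apply, rightMulL_apply, leftMul_toMultiplier_ofCc, rightMul_toMultiplier_ofCc]
      simp only [h]

end Conjugation

end HilbertBimodule

/-! ### From unitary representations to bimodules. -/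

section Reps

variable {G : Type u} [Group G] [TopologicalSpace G] [IsTopologicalGroup G] [LocallyCompactSpace G]
  [T2Space G] [MeasurableSpace G] [BorelSpace G]
  {K : Type u} [Group K] [TopologicalSpace K] [IsTopologicalGroup K] [LocallyCompactSpace K]
  [T2Space K] [MeasurableSpace K] [BorelSpace K]
  {E : Type u} [NormedAddCommGroup E] [InnerProductSpace ℂ E] [CompleteSpace E]

variable (G E) in
/-- The trivial representation of `G` on `E`. -/
def trivialRep : UnitaryRep G E where
  toHom := 1
  continuous_apply _ := continuous_const

theorem trivialRep_op (g : G) : (trivialRep G E).op g = 1 := rfl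

theorem trivialRep_integral (f : C_c(G, ℂ)) :
    (trivialRep G E).integral f = (∫ x, f x ∂(Measure.haar : Measure G)) • 1 := by
  ext ξ
  rw [UnitaryRep.integral_apply]
  simp only [trivialRep_op]
  exact integral_smul_const (fun x => f x) ξ

/-- `C_c(G)` acts by the scalars `∫ f`. Hence the trivial representation is also an
anti-representation, and it commutes with any left action. -/
theorem commute_trivialRep_lift (T : E →L[ℂ] E) (a : GroupCStar G) :
    Commute ((trivialRep G E).lift a) T := by
  refine GroupCStar.induction (p := fun a => Commute ((trivialRep G E).lift a) T) a
    (isClosed_eq (by fun_prop) (by fun_prop)) fun f => ?_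
  rw [UnitaryRep.lift_ofCc, trivialRep_integral]
  exact (Commute.one_left T).smul_left _

theorem trivialRep_lift_ofCc {f : C_c(G, ℂ)} (hf : ∫ x, f x ∂(Measure.haar : Measure G) = 1) :
    (trivialRep G E).lift (ofCc f) = 1 := by
  rw [UnitaryRep.lift_ofCc, trivialRep_integral, hf, one_smul]

namespace UnitaryRep

/-- The integrated form of a unitary representation as a *-homomorphism. -/
def liftHom (π : UnitaryRep G E) : GroupCStar G →⋆ₙₐ[ℂ] (E →L[ℂ] E) where
  toFun := π.lift
  map_smul' c x := map_smul π.lift c x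
  map_zero' := map_zero π.lift
  map_add' x y := map_add π.lift x y
  map_mul' := π.lift_mul
  map_star' := π.lift_star

/-- If `η` is orthogonal to all `π(f) ξ`, then `x ↦ ⟨η, π(x) ξ⟩` is continuous and annihilated by
`C_c(G)`; its value at `1` gives `⟨η, ξ⟩ = 0`. -/
theorem isNondegenerate_liftHom (π : UnitaryRep G E) : IsNondegenerate π.liftHom := by
  rw [IsNondegenerate, Submodule.topologicalClosure_eq_top_iff, Submodule.eq_bot_iff]
  intro η hη
  refine ext_inner_left ℂ fun ξ => ?_
  rw [inner_zero_right, ← inner_conj_symm]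
  have h (f : C_c(G, ℂ)) :
      ∫ x, f x • inner ℂ η (π.op x ξ) ∂(Measure.haar : Measure G) = 0 := by
    have h1 : inner ℂ η (π.integral f ξ) = 0 := by
      have hmem : π.integral f ξ ∈
          Submodule.span ℂ {η : E | ∃ (a : GroupCStar G) (ξ : E), π.liftHom a ξ = η} :=
        Submodule.subset_span ⟨ofCc f, ξ, congrArg (fun T : E →L[ℂ] E => T ξ) (π.lift_ofCc f)⟩
      exact Submodule.inner_left_of_mem_orthogonal hmem hη
    rw [← h1, integral_apply, ← integral_inner (π.integrable_smul_op f ξ)]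
    simp only [inner_smul_right, smul_eq_mul]
  have h2 := eq_zero_of_forall_integral_smul_eq_zero
    (continuous_const.inner (π.continuous_op ξ)) h 1
  rw [op_one] at h2
  change inner ℂ η ξ = 0 at h2
  rw [h2, map_zero]

variable (G E) in
/-- The trivial representation of `C*(G)` as a *-representation of the opposite algebra. -/
def trivialOp : (GroupCStar G)ᵐᵒᵖ →⋆ₙₐ[ℂ] (E →L[ℂ] E) where
  toFun a := (trivialRep G E).lift a.unop
  map_smul' c x := map_smul (trivialRep G E).lift c x.unop
  map_zero' := map_zero (trivialRep G E).lift
  map_add' x y := map_add (trivialRep G E).lift x.unop y.unop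
  map_mul' x y := by
    rw [MulOpposite.unop_mul, lift_mul]
    -- The reversed order of multiplication is harmless, the operators being scalars.
    exact commute_trivialRep_lift _ _
  map_star' x := (trivialRep G E).lift_star x.unop

variable (G E) in
theorem isNondegenerate_trivialOp : IsNondegenerate (trivialOp G E) := by
  obtain ⟨f, hf⟩ := exists_integral_eq_one (G := G)
  have h : Submodule.span ℂ {η : E | ∃ a ξ, trivialOp G E a ξ = η} = ⊤ := by
    refine Submodule.eq_top_iff'.2 fun ξ =>
      Submodule.subset_span ⟨MulOpposite.op (ofCc f), ξ, ?_⟩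
    exact congrArg (fun T => T ξ) (trivialRep_lift_ofCc hf)
  rw [IsNondegenerate, h]
  exact top_unique (Submodule.le_topologicalClosure _)

/-- The bimodule over `C*(G)` whose left action is a unitary representation of `G` and whose right
action is trivial. -/
def bimodule (π : UnitaryRep G E) : HilbertBimodule (GroupCStar G) E where
  left := π.liftHom
  right := trivialOp G E
  left_right_comm a b ξ :=
    congrArg (fun T : E →L[ℂ] E => T ξ) (commute_trivialRep_lift (π.lift a) b).eq.symm
  left_nondegenerate := π.isNondegenerate_liftHom
  right_nondegenerate := isNondegenerate_trivialOp G E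

theorem bimodule_leftMul_groupMultiplier (π : UnitaryRep G E) (g : G) :
    π.bimodule.leftMul (groupMultiplier g) = π.op g :=
  (π.bimodule.leftMul_unique _ _ fun a ξ =>
    congrArg (fun T : E →L[ℂ] E => T ξ) (lift_transL π g a).symm).symm

theorem bimodule_rightMul_groupMultiplier (π : UnitaryRep G E) (g : G) :
    π.bimodule.rightMul (groupMultiplier g) = 1 :=
  (π.bimodule.rightMul_unique _ _ fun a ξ =>
    congrArg (fun T : E →L[ℂ] E => T ξ)
      (lift_groupMultiplier_snd (trivialRep G E) g a).symm).symm

theorem bimodule_conjRep_op_eq_self_iff (π : UnitaryRep G E) (g : G) (ξ : E) :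
    π.bimodule.conjRep.op g ξ = ξ ↔ π.op g ξ = ξ := by
  rw [HilbertBimodule.conjRep_op_eq_self_iff, bimodule_leftMul_groupMultiplier,
    bimodule_rightMul_groupMultiplier]
  rfl

variable {ι : Type*} [Preorder ι] {ξ : ι → E}

theorem IsAlmostInvariant.eventually_norm_integral_sub_lt {π : UnitaryRep G E}
    (h : π.IsAlmostInvariant ξ) (f : C_c(G, ℂ)) {ε : ℝ} (hε : 0 < ε) :
    ∀ᶠ i in atTop, ‖π.integral f (ξ i) - (trivialRep G E).integral f (ξ i)‖ < ε := by
  -- The added `1` keeps the denominator positive when `f = 0`.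
  have hpos : 0 < (∫ x, ‖f x‖ ∂(Measure.haar : Measure G)) + 1 :=
    add_pos_of_nonneg_of_pos (integral_nonneg fun _ => norm_nonneg _) one_pos
  filter_upwards [h _ f.hasCompactSupport.isCompact _ (div_pos hε hpos)] with i hi
  have hf : Integrable (fun x => f x) (Measure.haar : Measure G) :=
    f.continuous_toFun.integrable_of_hasCompactSupport f.hasCompactSupport
  rw [integral_apply, integral_apply, ← integral_sub (π.integrable_smul_op f _)
    ((trivialRep G E).integrable_smul_op f _)]
  have hle : ∀ x, ‖f x • π.op x (ξ i) - f x • (trivialRep G E).op x (ξ i)‖ ≤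
      ‖f x‖ * (ε / ((∫ x, ‖f x‖ ∂(Measure.haar : Measure G)) + 1)) := fun x => by
    rw [← smul_sub, norm_smul]
    by_cases hx : x ∈ tsupport f
    · exact mul_le_mul_of_nonneg_left (hi x hx).le (norm_nonneg _)
    · rw [image_eq_zero_of_notMem_tsupport hx, norm_zero, zero_mul, zero_mul]
  refine (norm_integral_le_of_norm_le (hf.norm.mul_const _)
    (Eventually.of_forall hle)).trans_lt ?_
  rw [integral_mul_const, ← mul_div_assoc, div_lt_iff₀ hpos]
  nlinarith

theorem norm_lift_sub_lift_le (π σ : UnitaryRep G E) (a : GroupCStar G) {ζ : E} (hζ : ‖ζ‖ = 1) :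
    ‖π.lift a ζ - σ.lift a ζ‖ ≤ 2 * ‖a‖ := by
  have h1 := (π.lift a).le_of_opNorm_le (π.norm_lift_le a) ζ
  have h2 := (σ.lift a).le_of_opNorm_le (σ.norm_lift_le a) ζ
  rw [hζ, mul_one] at h1 h2
  linarith [norm_sub_le (π.lift a ζ) (σ.lift a ζ)]

/-- Compactness of `C` reduces the uniform estimate to finitely many elements of `C_c(G)`, since `π`
and the trivial representation are both contractive on `C*(G)`. -/
theorem IsAlmostInvariant.eventually_norm_lift_sub_lt {π : UnitaryRep G E}
    (h : π.IsAlmostInvariant ξ) (h1 : ∀ i, ‖ξ i‖ = 1) {C : Set (GroupCStar G)} (hC : IsCompact C)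
    {ε : ℝ} (hε : 0 < ε) :
    ∀ᶠ i in atTop, ∀ a ∈ C, ‖π.lift a (ξ i) - (trivialRep G E).lift a (ξ i)‖ < ε := by
  -- Each `a` is within `ε/8` of some `b` in `t`, and `b` within `ε/8` of `F b`. The error `ε/4`
  -- counts once for each representation, which leaves `ε/2` for `F b`.
  obtain ⟨t, -, ht, hcover⟩ := hC.finite_cover_balls (show 0 < ε / 8 by positivity)
  have happrox (b : GroupCStar G) : ∃ f : C_c(G, ℂ), dist b (ofCc f) < ε / 8 :=
    denseRange_ofCcL.exists_dist_lt b (by positivity)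
  choose F hF using happrox
  filter_upwards [(Filter.eventually_all_finite ht).2 fun b _ =>
    h.eventually_norm_integral_sub_lt (F b) (half_pos hε)] with i hi a ha
  obtain ⟨b, hb, hab⟩ := Set.mem_iUnion₂.1 (hcover ha)
  have hdist : ‖a - ofCc (F b)‖ < ε / 4 := by
    rw [← dist_eq_norm]
    linarith [dist_triangle a b (ofCc (F b)), Metric.mem_ball.1 hab, hF b]
  have h2 := norm_lift_sub_lift_le π (trivialRep G E) (a - ofCc (F b)) (h1 i)
  have h3 := hi b hb
  have h4 : π.lift a (ξ i) - (trivialRep G E).lift a (ξ i) =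
      (π.lift (a - ofCc (F b)) (ξ i) - (trivialRep G E).lift (a - ofCc (F b)) (ξ i)) +
      (π.integral (F b) (ξ i) - (trivialRep G E).integral (F b) (ξ i)) := by
    rw [map_sub, map_sub, ← lift_ofCc, ← lift_ofCc, _root_.sub_apply, _root_.sub_apply]
    abel
  rw [h4]
  linarith [norm_add_le
    (π.lift (a - ofCc (F b)) (ξ i) - (trivialRep G E).lift (a - ofCc (F b)) (ξ i))
    (π.integral (F b) (ξ i) - (trivialRep G E).integral (F b) (ξ i))]

end UnitaryRep

/-! ### Strictly compact sets, almost central nets and the relative equivalence. -/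

theorem isCompact_image_fst {A : Type*} [NonUnitalCStarAlgebra A] {L : Set 𝓜(ℂ, A)}
    (hL : @IsCompact _ (strictTopology A) L) (a : A) :
    IsCompact ((fun x : 𝓜(ℂ, A) => x.fst a) '' L) := by
  let _ := strictTopology A
  have h : strictTopology A ≤ TopologicalSpace.induced (fun x => x.fst a) inferInstance :=
    iInf_le_of_le a inf_le_left
  exact hL.image (continuous_iff_le_induced.2 h)

/-- A strictly compact set is pointwise bounded as a family of operators on the Banach space `A`,
hence uniformly bounded. -/
theorem exists_norm_le_of_isCompact_strictTopology {A : Type*} [NonUnitalCStarAlgebra A]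
    {L : Set 𝓜(ℂ, A)} (hL : @IsCompact _ (strictTopology A) L) : ∃ C, ∀ x ∈ L, ‖x‖ ≤ C := by
  obtain ⟨C, hC⟩ := banach_steinhaus (g := fun x : L => x.1.fst) fun a => by
    obtain ⟨C, hC⟩ := (isCompact_image_fst hL a).isBounded.exists_norm_le
    exact ⟨C, fun x => hC _ ⟨x.1, x.2, rfl⟩⟩
  exact ⟨C, fun x hx => by rw [← DoubleCentralizer.norm_fst]; exact hC ⟨x, hx⟩⟩

/-- Expresses the right action through `x f`, the same element that governs the left action on `f ·
ξ`. -/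
theorem UnitaryRep.bimodule_rightMul (π : UnitaryRep G E) {f : C_c(G, ℂ)}
    (hf : ∫ x, f x ∂(Measure.haar : Measure G) = 1) (x : 𝓜(ℂ, GroupCStar G)) :
    π.bimodule.rightMul x = (trivialRep G E).lift (x.fst (ofCc f)) := by
  have h1 : π.bimodule.rightMul x = (trivialRep G E).lift (x.snd (ofCc f)) := by
    ext ξ
    have h := π.bimodule.rightMul_right x (ofCc f) ξ
    change π.bimodule.rightMul x ((trivialRep G E).lift (ofCc f) ξ) =
      (trivialRep G E).lift (x.snd (ofCc f)) ξ at h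
    rwa [trivialRep_lift_ofCc hf] at h
  -- Applied to `(f x) f = f (x f)`, the trivial representation, which sends `f` to `1`, cannot tell
  -- `f x` from `x f`.
  have h2 := congrArg (trivialRep G E).lift (x.central (ofCc f) (ofCc f))
  rw [lift_mul, lift_mul, trivialRep_lift_ofCc hf, mul_one, one_mul] at h2
  rw [h1, h2]

/-- Fix `f` of integral `1`, and let `τ` be the trivial representation. Then `x · ξ ≈ x · (f · ξ) =
(x f) · ξ ≈ τ(x f) ξ = ξ · x`. The first approximation is uniform in `x` because `L` is norm
bounded, the second because `L f` is norm compact. -/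
theorem UnitaryRep.IsAlmostInvariant.isAlmostCentral {π : UnitaryRep G E} {ι : Type*} [Preorder ι]
    {ξ : ι → E} (h : π.IsAlmostInvariant ξ) (h1 : ∀ i, ‖ξ i‖ = 1) :
    π.bimodule.IsAlmostCentral ξ := by
  intro L hL ε hε
  obtain ⟨f, hf⟩ := exists_integral_eq_one (G := G)
  obtain ⟨C, hC⟩ := exists_norm_le_of_isCompact_strictTopology hL
  -- `|C| + 1` is positive whatever `C` is; with this divisor the error `ξ i - f · ξ i`, after
  -- multiplication by `x`, is at most `ε / 2`.
  have hpos : 0 < 2 * (|C| + 1) := by positivity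
  filter_upwards [h.eventually_norm_lift_sub_lt h1 (isCompact_image_fst hL (ofCc f)) (half_pos hε),
    h.eventually_norm_integral_sub_lt f (div_pos hε hpos)] with i hi hfi x hx
  rw [π.bimodule_rightMul hf]
  have h2 : π.bimodule.leftMul x (π.lift (ofCc f) (ξ i)) = π.lift (x.fst (ofCc f)) (ξ i) :=
    π.bimodule.leftMul_left x (ofCc f) (ξ i)
  have h3 := hi _ ⟨x, hx, rfl⟩
  beta_reduce at h3
  rw [← h2] at h3
  have h4 : ‖π.bimodule.leftMul x (ξ i - π.lift (ofCc f) (ξ i))‖ ≤ ε / 2 := by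
    refine ((π.bimodule.leftMul x).le_of_opNorm_le
      ((π.bimodule.norm_leftMul_le x).trans (hC x hx)) _).trans ?_
    rw [← lift_ofCc, ← lift_ofCc, trivialRep_lift_ofCc hf, norm_sub_rev,
      lt_div_iff₀ hpos] at hfi
    change ‖ξ i - π.lift (ofCc f) (ξ i)‖ * _ < ε at hfi
    nlinarith [norm_nonneg (ξ i - π.lift (ofCc f) (ξ i)), le_abs_self C]
  rw [map_sub] at h4
  calc _ ≤ _ := norm_sub_le_norm_sub_add_norm_sub _
        (π.bimodule.leftMul x (π.lift (ofCc f) (ξ i))) _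
    _ < ε := by linarith

/-- Relative Property (T) of `G` with respect to the image of `φ : K → G` is Property (T) of
`C*(G)` relative to the image of `C*(K)` in `M(C*(G))`. -/
theorem kazhdan_iff_pairPropertyT (φ : K →ₜ* G) :
    KazhdanPairPropertyT G φ.toMonoidHom.range ↔
      PairPropertyT (GroupCStar G) (NonUnitalStarAlgHom.range (toMultiplier φ)) := by
  constructor
  · intro h E _ _ _ M ι _ _ _ ξ h1 hξ
    obtain ⟨η, hη, hinv⟩ := h E M.conjRep ι ξ h1 hξ.isAlmostInvariant
    exact ⟨η, (M.mem_centralVectors_range_toMultiplier φ).2 fun k => hinv _ ⟨k, rfl⟩, hη⟩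
  · intro h E _ _ _ π ι _ _ _ ξ h1 hξ
    obtain ⟨η, hη, hne⟩ := h E π.bimodule ι ξ h1 (hξ.isAlmostCentral h1)
    refine ⟨η, hne, ?_⟩
    rintro _ ⟨k, rfl⟩
    exact (π.bimodule_conjRep_op_eq_self_iff _ _).1
      ((π.bimodule.mem_centralVectors_range_toMultiplier φ).1 hη k)

theorem kazhdan_iff_cStarPropertyT :
    KazhdanPropertyT G ↔ CStarPropertyT (GroupCStar G) := by
  have h : (ContinuousMonoidHom.id G).toMonoidHom.range = ⊤ :=
    MonoidHom.range_eq_top.2 fun g => ⟨g, rfl⟩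
  rw [KazhdanPropertyT, CStarPropertyT, ← range_toMultiplier_id, ← kazhdan_iff_pairPropertyT, h]

end Reps

/-! ### Strong Property (T) through the complement of the fixed vectors. -/

section Strong

namespace UnitaryRep

variable {G : Type*} [Group G] [TopologicalSpace G]
  {E : Type*} [NormedAddCommGroup E] [InnerProductSpace ℂ E] [CompleteSpace E]

/-- The restriction of a unitary representation to a closed invariant subspace. -/
def restrict (π : UnitaryRep G E) (S : Submodule ℂ E) [CompleteSpace S]
    (hS : ∀ g, ∀ ξ ∈ S, π.op g ξ ∈ S) : UnitaryRep G S :=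
  let T (g : G) : S →L[ℂ] S := (π.op g).restrict (hS g)
  have hTm (g h : G) : T (g * h) = T g * T h := by
    ext ξ
    change π.op (g * h) ξ = π.op g (π.op h ξ)
    rw [π.op_mul]; rfl
  have hT1 : T 1 = 1 := by
    ext ξ
    change π.op 1 ξ = ξ
    rw [π.op_one]; rfl
  have hTs (g : G) : star (T g) = T g⁻¹ := by
    rw [ContinuousLinearMap.star_eq_adjoint, eq_comm, ContinuousLinearMap.eq_adjoint_iff]
    intro ξ η
    change inner ℂ (π.op g⁻¹ ξ) (η : E) = inner ℂ (ξ : E) (π.op g η)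
    rw [← π.star_op, ContinuousLinearMap.star_eq_adjoint, ContinuousLinearMap.adjoint_inner_left]
  have hTu (g : G) : T g ∈ unitary (S →L[ℂ] S) := Unitary.mem_iff.2 (by
    rw [hTs, ← hTm, ← hTm, inv_mul_cancel, mul_inv_cancel, hT1]; exact ⟨rfl, rfl⟩)
  { toHom := MonoidHom.mk' (fun g => ⟨T g, hTu g⟩) fun g h => Subtype.ext (hTm g h)
    continuous_apply := fun ξ => (π.continuous_op ξ).subtype_mk _ }

end UnitaryRep

/-- If the components orthogonal to the fixed space `S` did not tend to zero, a subnet of them,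
normalized, would be almost invariant in `Sᗮ`. Property (T) would then give a nonzero fixed vector
in `Sᗮ`, which is absurd. -/
theorem KazhdanPropertyT.tendsto_norm_sub_starProjection {G : Type u} [Group G]
    [TopologicalSpace G] (hG : KazhdanPropertyT G)
    {E : Type u} [NormedAddCommGroup E] [InnerProductSpace ℂ E] [CompleteSpace E]
    (π : UnitaryRep G E) {ι : Type u} [Preorder ι] [IsDirectedOrder ι] [Nonempty ι] {ξ : ι → E}
    (hξ : π.IsAlmostInvariant ξ) (S : Submodule ℂ E) [CompleteSpace S]
    (hS : ∀ η, η ∈ S ↔ ∀ g, π.op g η = η) :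
    Tendsto (fun i => ‖ξ i - S.starProjection (ξ i)‖) atTop (𝓝 0) := by
  have hinv (g : G) (ζ : E) (hζ : ζ ∈ Sᗮ) : π.op g ζ ∈ Sᗮ := fun η hη => by
    rw [← ContinuousLinearMap.adjoint_inner_left, ← ContinuousLinearMap.star_eq_adjoint,
      π.star_op, (hS η).1 hη]
    exact hζ η hη
  have hmem (ζ : E) : ζ - S.starProjection ζ ∈ Sᗮ := S.sub_starProjection_mem_orthogonal ζ
  -- Removing the fixed component does not change the displacement under `g`.
  have hproj (g : G) (ζ : E) : π.op g (ζ - S.starProjection ζ) - (ζ - S.starProjection ζ) =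
      π.op g ζ - ζ := by
    rw [map_sub, (hS _).1 (S.starProjection_apply_mem ζ) g]
    abel
  by_contra hnot
  obtain ⟨ε, hε, hfreq⟩ : ∃ ε > 0, ∃ᶠ i in atTop, ε ≤ ‖ξ i - S.starProjection (ξ i)‖ := by
    rw [Metric.tendsto_nhds] at hnot
    push Not at hnot
    simpa using hnot
  -- The indices with orthogonal component at least `ε` are cofinal, so they form a directed set
  -- along which almost invariance persists.
  let J := {i // ε ≤ ‖ξ i - S.starProjection (ξ i)‖}
  have hcof (i : ι) : ∃ j : J, i ≤ j.1 := by
    obtain ⟨j, hij, hj⟩ := frequently_atTop.1 hfreq i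
    exact ⟨⟨j, hj⟩, hij⟩
  have : Nonempty J := (hcof (Classical.arbitrary ι)).nonempty
  have : IsDirectedOrder J := ⟨fun i j => by
    obtain ⟨k, hik, hjk⟩ := exists_ge_ge i.1 j.1
    obtain ⟨l, hl⟩ := hcof k
    exact ⟨l, hik.trans hl, hjk.trans hl⟩⟩
  have hJ : Tendsto (Subtype.val : J → ι) atTop atTop :=
    tendsto_atTop_atTop.2 fun i => (hcof i).imp fun j hj k hk => hj.trans hk
  let c (j : J) : ℝ := ‖ξ j.1 - S.starProjection (ξ j.1)‖
  have hc (j : J) : 0 < c j := hε.trans_le j.2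
  let ζ (j : J) : Sᗮ := ((c j : ℂ)⁻¹) • ⟨ξ j.1 - S.starProjection (ξ j.1), hmem _⟩
  have hζ1 (j : J) : ‖ζ j‖ = 1 := by
    rw [norm_smul, norm_inv, Complex.norm_real, norm_norm]
    exact inv_mul_cancel₀ (hc j).ne'
  -- Normalizing divides by `c j ≥ ε`, so a displacement below `δ * ε` before normalization suffices
  -- for `δ` after it.
  obtain ⟨η, hne, hη⟩ := hG Sᗮ (π.restrict Sᗮ hinv) J ζ hζ1 fun Q hQ δ hδ => by
    filter_upwards [hJ.eventually (hξ Q hQ (δ * ε) (mul_pos hδ hε))] with j hj s hs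
    have h1 : (((π.restrict Sᗮ hinv).op s (ζ j) - ζ j : Sᗮ) : E) =
        ((c j : ℂ)⁻¹) • (π.op s (ξ j.1) - ξ j.1) := by
      rw [← hproj, smul_sub, ← map_smul]
      rfl
    change ‖(((π.restrict Sᗮ hinv).op s (ζ j) - ζ j : Sᗮ) : E)‖ < δ
    rw [h1, norm_smul, norm_inv, Complex.norm_real, Real.norm_of_nonneg
      (hc j).le, inv_mul_lt_iff₀ (hc j)]
    calc _ < δ * ε := hj s hs
      _ ≤ c j * δ := by rw [mul_comm]; exact mul_le_mul_of_nonneg_right j.2 hδ.le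
  refine hne (Subtype.ext ?_)
  have hηS : (η : E) ∈ S := (hS _).2 fun g => congrArg Subtype.val (hη g trivial)
  exact inner_self_eq_zero.1 (η.2 _ hηS)

/-- As soon as the unit vector `ξ i` is at distance less than `1` from its projection, that
projection is a nonzero central vector. -/
theorem CStarStrongPropertyT.cStarPropertyT {A : Type u} [NonUnitalCStarAlgebra A]
    (h : CStarStrongPropertyT A) : CStarPropertyT A := by
  intro E _ _ _ M ι _ _ _ ξ h1 hξ
  obtain ⟨i, hi⟩ := ((h E M ι ξ h1 hξ).eventually_lt_const one_pos).exists
  refine ⟨_, Submodule.starProjection_apply_mem _ (ξ i), fun h0 => ?_⟩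
  rw [h0, sub_zero, h1] at hi
  exact lt_irrefl _ hi

variable {G : Type u} [Group G] [TopologicalSpace G] [IsTopologicalGroup G] [LocallyCompactSpace G]
  [T2Space G] [MeasurableSpace G] [BorelSpace G]

theorem KazhdanPropertyT.cStarStrongPropertyT (h : KazhdanPropertyT G) :
    CStarStrongPropertyT (GroupCStar G) := by
  intro E _ _ _ M ι _ _ _ ξ _ hξ
  refine h.tendsto_norm_sub_starProjection M.conjRep hξ.isAlmostInvariant _ fun η => ?_
  rw [← range_toMultiplier_id]
  exact M.mem_centralVectors_range_toMultiplier (ContinuousMonoidHom.id G)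

end Strong

end

end KazhdanT

theorem theorem1p1 {G : Type u} [Group G] [TopologicalSpace G] [IsTopologicalGroup G]
    [LocallyCompactSpace G] [T2Space G] [MeasurableSpace G] [BorelSpace G]
    (H : Subgroup G) (hH : IsClosed (H : Set G)) :
    (KazhdanT.KazhdanPairPropertyT G H ↔
      KazhdanT.PairPropertyT (KazhdanT.GroupCStar G) (KazhdanT.subgroupImage H hH)) ∧
    (KazhdanT.KazhdanPropertyT G ↔ KazhdanT.CStarPropertyT (KazhdanT.GroupCStar G)) ∧
    (KazhdanT.KazhdanPropertyT G ↔ KazhdanT.CStarStrongPropertyT (KazhdanT.GroupCStar G)) := by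
  refine ⟨?_, KazhdanT.kazhdan_iff_cStarPropertyT, fun h => h.cStarStrongPropertyT,
    fun h => KazhdanT.kazhdan_iff_cStarPropertyT.2 h.cStarPropertyT⟩
  -- Closedness makes `H` locally compact, so the general equivalence applies to its inclusion in
  -- `G`.
  have : LocallyCompactSpace H := hH.isClosedEmbedding_subtypeVal.locallyCompactSpace
  have h := KazhdanT.kazhdan_iff_pairPropertyT (KazhdanT.subgroupIncl H)
  rwa [show (KazhdanT.subgroupIncl H).toMonoidHom.range = H from H.range_subtype] at h
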